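/- For a real matrix $M$ let $\|M\|$ be its $\ell_2\to\ell_2$ operator norm, let $\preceq$ be the positive-semidefinite order on real symmetric matrices, let $e_1,\dots,e_n$ be the standard basis vectors, and let $\oplus$ be coordinatewise addition modulo $2$ on $\{0,1\}^n$. For binary vectors $x,y$ with the same finite index set, $x$ covers $y$, written $x\triangleright y$, if $x=y$ or $x=y+e_i$ (sum in $\mathbb R$) for some index $i$. Let $X=(X_1,\dots,X_n)$ be a random vector with values in $\{0,1\}^n$. It is $k$-homogeneous if $\sum_{i=1}^n X_i=k$ almost surely. It satisfies the Stochastic Covering Property (SCP) if for every $\Lambda\subseteq[n]$ and all $x,y\in\{0,1\}^n$ with $\mathbb P(X_\Lambda=x_\Lambda)>0$, $\mathbb P(X_\Lambda=y_\Lambda)>0$ and $x_\Lambda\triangleright y_\Lambda$, there is a coupling $(Y,Q)$ of the conditional distributions $\mathbb P(X_{\Lambda^c}\in\cdot\mid X_\Lambda=y_\Lambda)$ (the law of $Y$) and $\mathbb P(X_{\Lambda^c}\in\cdot\mid X_\Lambda=x_\Lambda)$ (the law of $Q$) such that $Y\triangleright Q$ almost surely. **Theorem.** There is an absolute constant $C>0$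 such that the following holds for all integers $n,k\ge 0$ and $d\ge1$. Let $X$ be a $k$-homogeneous $\{0,1\}^n$-valued random vector satisfying the SCP. Let $f$ be a function from $\{0,1\}^n$ to the real symmetric $d\times d$ matrices, and let $A_1,\dots,A_n$ be nonnegative definite real symmetric $d\times d$ matrices such that, for all $i\in[n]$ and all $x\in\{0,1\}^n$, $$(f(x)-f(x\oplus e_i))^2\preceq A_i^2 .$$ Then for every $t\ge 0$, $$\mathbb P\big(\|f(X)-\mathbb E f(X)\|\ge t\big)\le 2d\exp\Big(-\frac1C\min\Big(\frac{t^2}{\sigma^2},\frac tR\Big)\Big),$$ where $\sigma^2=\big\|\mathbb E\sum_{i=1}^n X_iA_i^2\big\|$ and $R=\max_{i\le n}\|A_i\|$ (with $R=0$ if $n=0$). Here $a/0=\infty$ for $a>0$, $0/0=0$ and $e^{-\infty}=0$. -/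

import Mathlib

open MeasureTheory
open scoped ENNReal Matrix.Norms.L2Operator

namespace BinaryConcentration

/-- The value in `{0, 1} ⊆ ℝ` of a bit. -/
def bit (b : Bool) : ℝ := if b then 1 else 0

/-- `x ⊕ e_i`: coordinatewise sum modulo 2 of `x` and the `i`-th standard basis vector. -/
def xorBasis {n : ℕ} (x : Fin n → Bool) (i : Fin n) : Fin n → Bool :=
  fun j => xor (x j) (decide (j = i))

/-- `x` covers `y`: either `x = y`, or `x = y + e_i` for some index `i` (sum in `ℝ`, so that
necessarily `y_i = 0` and `x_i = 1`). -/
def Covers {I : Type} (x y : I → Bool) : Prop :=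
  x = y ∨ ∃ i, y i = false ∧ x i = true ∧ ∀ j, j ≠ i → x j = y j

/-- A law on `{0,1}^n` is `k`-homogeneous if almost surely exactly `k` coordinates equal `1`. -/
def IsHomogeneous {n : ℕ} (k : ℕ) (μ : Measure (Fin n → Bool)) : Prop :=
  ∀ᵐ x ∂μ, ∑ i, bit (x i) = (k : ℝ)

/-- The event `{X_Λ = x_Λ}` for the canonical vector on `{0,1}^n`. -/
def agreeOn {n : ℕ} (Λ : Finset (Fin n)) (x : Fin n → Bool) : Set (Fin n → Bool) :=
  {z | Λ.restrict z = Λ.restrict x}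

/-- The conditional law `P(X_{Λᶜ} ∈ · | X_Λ = x_Λ)`, as a measure on `{0,1}^{Λᶜ}`, when `X` has
law `μ`. -/
noncomputable def condLaw {n : ℕ} (μ : Measure (Fin n → Bool)) (Λ : Finset (Fin n))
    (x : Fin n → Bool) : Measure ((i : (Λᶜ : Finset (Fin n))) → Bool) :=
  (ProbabilityTheory.cond μ (agreeOn Λ x)).map (Λᶜ).restrict

/-- The Stochastic Covering Property of a law on `{0,1}^n`. The measure `π` is the joint law of the
coupling `(Y, Q)`. -/
def StochasticCovering {n : ℕ} (μ : Measure (Fin n → Bool)) : Prop :=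
  ∀ (Λ : Finset (Fin n)) (x y : Fin n → Bool),
    0 < μ (agreeOn Λ x) → 0 < μ (agreeOn Λ y) →
    Covers (Λ.restrict x) (Λ.restrict y) →
    ∃ π : Measure (((i : (Λᶜ : Finset (Fin n))) → Bool) × ((i : (Λᶜ : Finset (Fin n))) → Bool)),
      π.map Prod.fst = condLaw μ Λ y ∧
      π.map Prod.snd = condLaw μ Λ x ∧
      ∀ᵐ p ∂π, Covers p.1 p.2

/-- `σ² = ‖E ∑ i, X_i A_i²‖`, with the `ℓ₂ → ℓ₂` operator norm. -/
noncomputable def varianceProxy {Ω : Type*} [MeasurableSpace Ω] (P : Measure Ω) {n d : ℕ}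
    (X : Ω → Fin n → Bool) (A : Fin n → Matrix (Fin d) (Fin d) ℝ) : ℝ :=
  ‖∫ ω, ∑ i, bit (X ω i) • (A i) ^ 2 ∂P‖

/-- `R = max_i ‖A_i‖`, with the `ℓ₂ → ℓ₂` operator norm (and `R = 0` if `n = 0`). -/
noncomputable def maxNorm {n d : ℕ} (A : Fin n → Matrix (Fin d) (Fin d) ℝ) : ℝ :=
  ⨆ i, ‖A i‖

/-- `min (t² / s, t / R)` for `t, s, R ≥ 0`, in `[0, ∞]`: for `a > 0` one has `a / 0 = ∞`, and
`0 / 0 = 0`. -/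
noncomputable def bernsteinRate (t s R : ℝ) : ℝ≥0∞ :=
  min (ENNReal.ofReal (t ^ 2) / ENNReal.ofReal s) (ENNReal.ofReal t / ENNReal.ofReal R)

end BinaryConcentration

namespace BinaryConcentration

open Filter Topology
open scoped MatrixOrder

/-! ### The Lie–Trotter product formula -/

/-! Write `S i = A i ^ 2`. The ones of `X` are revealed one at a time, the next being uniform among
the ones not yet revealed. Given that the coordinates in `T` are ones and `m` ones remain, `i` is
revealed with probability `p i / m`, where `p i` is the conditional probability of `X i = 1`.
Conditional means of functions of `X` are martingales along this exploration, and by homogeneity `X`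
is determined after `k` steps.

The increments are controlled by a swap. Under homogeneity the covering property couples the laws
given `X i = 1` and given `X i = 0` so that the two vectors differ by moving one unit from `i` to
some `l`. If flipping `j` changes `F` by at most `K • S j` in square, the swap costs at most `2K (S
i + S l)`. Let `g` be the sum of the `S j` over the unrevealed ones. Then `S i + S l` is the change
of `g` under the swap plus `2 S i`; averaged over `i` the change of `g` cancels, again by the
martingale property. So the total squared increment is at most a multiple of the conditional mean of
`g` (`sum_smul_sq_mean_insert_sub_mean_le`).

This conditional variance is random, so it is carried in the exponent: `mean_trace_exp_le` bounds
the conditional mean of `tr exp (H + θ f)` by `tr exp (H + θ E f + 32 θ² E g)`, by induction on the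
number of unrevealed ones. Revealing `i` removes `S i` from `g`, and this pays for the step. Each
step (`sum_trace_exp_add_le`) uses Golden–Thompson to split off the increment, `exp Z ≤ 1 + Z + Z²`
for `Z ≤ 1`, and then convexity of `tr exp` to return the averaged variance to the exponent. A
Chernoff bound with optimized `θ` finishes. -/

lemma norm_exp_le_exp_norm {𝔸 : Type*} [NormedRing 𝔸] [NormOneClass 𝔸] [NormedAlgebra ℝ 𝔸]
    [CompleteSpace 𝔸] (x : 𝔸) : ‖NormedSpace.exp x‖ ≤ Real.exp ‖x‖ := by
  rw [NormedSpace.exp_eq_tsum ℝ, Real.exp_eq_exp_ℝ, NormedSpace.exp_eq_tsum ℝ]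
  refine tsum_of_norm_bounded (NormedSpace.expSeries_summable' (𝕂 := ℝ) ‖x‖).hasSum fun n => ?_
  rw [norm_smul, smul_eq_mul, norm_inv, RCLike.norm_natCast]
  gcongr
  exact norm_pow_le x n

lemma norm_pow_sub_pow_le {𝔸 : Type*} [NormedRing 𝔸] [NormOneClass 𝔸] (X Y : 𝔸) {c : ℝ}
    (hX : ‖X‖ ≤ c) (hY : ‖Y‖ ≤ c) (hc : 1 ≤ c) (N : ℕ) :
    ‖X ^ N - Y ^ N‖ ≤ N * ‖X - Y‖ * c ^ N := by
  induction N with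
  | zero => simp
  | succ N ih =>
    have hc0 : 0 ≤ c := by linarith
    have e : X ^ (N + 1) - Y ^ (N + 1) = (X ^ N - Y ^ N) * X + Y ^ N * (X - Y) := by
      rw [pow_succ, pow_succ]; noncomm_ring
    rw [e]
    have h1 : ‖(X ^ N - Y ^ N) * X‖ ≤ N * ‖X - Y‖ * c ^ N * c :=
      (norm_mul_le _ _).trans (mul_le_mul ih hX (norm_nonneg _) (by positivity))
    have h2 : ‖Y ^ N * (X - Y)‖ ≤ c ^ (N + 1) * ‖X - Y‖ := by
      refine (norm_mul_le _ _).trans (mul_le_mul_of_nonneg_right ?_ (norm_nonneg _))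
      exact ((norm_pow_le Y N).trans (pow_le_pow_left₀ (norm_nonneg _) hY N)).trans
        (pow_le_pow_right₀ hc N.le_succ)
    refine (norm_add_le _ _).trans ((add_le_add h1 h2).trans (le_of_eq ?_))
    push_cast; ring

/-- At scale `s = 1/N` the product of exponentials and `exp (s • (A + B))` have the same value and
derivative at `s = 0`, so they differ by `o(1/N)`. Replacing the `N` factors one by one costs `N ·
o(1/N)` times a bounded factor. -/
theorem tendsto_exp_mul_exp_pow {d : ℕ} [NeZero d] (A B : Matrix (Fin d) (Fin d) ℝ) :
    Tendsto (fun N : ℕ => (NormedSpace.exp ((N : ℝ)⁻¹ • A) * NormedSpace.exp ((N : ℝ)⁻¹ • B)) ^ N)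
      atTop (𝓝 (NormedSpace.exp (A + B))) := by
  have : NormOneClass (Matrix (Fin d) (Fin d) ℝ) := ⟨CStarRing.norm_one⟩
  set g : ℝ → Matrix (Fin d) (Fin d) ℝ := fun t =>
    NormedSpace.exp (t • A) * NormedSpace.exp (t • B) - NormedSpace.exp (t • (A + B)) with hg
  have hder : HasDerivAt g 0 0 := by
    have h := ((hasDerivAt_exp_smul_const A (0 : ℝ)).mul
      (hasDerivAt_exp_smul_const B (0 : ℝ))).sub (hasDerivAt_exp_smul_const (A + B) (0 : ℝ))
    simp only [zero_smul, NormedSpace.exp_zero, one_mul, mul_one, sub_self] at h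
    exact h
  have hg0 : g 0 = 0 := by simp [hg, NormedSpace.exp_zero]
  have hinv : Tendsto (fun N : ℕ => (N : ℝ)⁻¹) atTop (𝓝[≠] 0) :=
    tendsto_nhdsWithin_iff.2 ⟨tendsto_inv_atTop_nhds_zero_nat,
      (eventually_gt_atTop 0).mono fun N hN => by simp; omega⟩
  have hsl : Tendsto (fun N : ℕ => (N : ℝ) • g ((N : ℝ)⁻¹)) atTop (𝓝 0) := by
    refine ((hasDerivAt_iff_tendsto_slope_zero.1 hder).comp hinv).congr fun N => ?_
    simp [hg0]
  have hn := hsl.norm.mul_const (Real.exp (‖A‖ + ‖B‖))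
  rw [norm_zero, zero_mul] at hn
  rw [tendsto_iff_norm_sub_tendsto_zero]
  refine squeeze_zero' (Eventually.of_forall fun _ => norm_nonneg _) ?_ hn
  filter_upwards [eventually_gt_atTop 0] with N hN
  have hN' : (N : ℝ) ≠ 0 := by positivity
  set s : ℝ := (N : ℝ)⁻¹
  have hs : 0 ≤ s := by positivity
  have e1 : NormedSpace.exp (A + B) = NormedSpace.exp (s • (A + B)) ^ N := by
    rw [← Matrix.exp_nsmul, ← Nat.cast_smul_eq_nsmul ℝ, smul_smul, mul_inv_cancel₀ hN', one_smul]
  set c : ℝ := Real.exp (s * (‖A‖ + ‖B‖))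
  have hnorm : ∀ M : Matrix (Fin d) (Fin d) ℝ, ‖NormedSpace.exp (s • M)‖ ≤ Real.exp (s * ‖M‖) := by
    intro M
    refine (norm_exp_le_exp_norm _).trans (le_of_eq ?_)
    rw [norm_smul, Real.norm_of_nonneg hs]
  have hX : ‖NormedSpace.exp (s • A) * NormedSpace.exp (s • B)‖ ≤ c := by
    refine (norm_mul_le _ _).trans ?_
    simp only [c, mul_add, Real.exp_add]
    exact mul_le_mul (hnorm A) (hnorm B) (norm_nonneg _) (Real.exp_nonneg _)
  have hY : ‖NormedSpace.exp (s • (A + B))‖ ≤ c :=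
    (hnorm _).trans (Real.exp_le_exp.2 (mul_le_mul_of_nonneg_left (norm_add_le _ _) hs))
  have hc : 1 ≤ c := Real.one_le_exp (by positivity)
  rw [e1]
  refine (norm_pow_sub_pow_le _ _ hX hY hc N).trans (le_of_eq ?_)
  rw [norm_smul, RCLike.norm_natCast, ← Real.exp_nat_mul]
  congr 2
  simp only [s]
  field_simp

/-! ### The Golden–Thompson inequality -/

section Trace

variable {ι : Type*} [Fintype ι]

lemma trace_mul_le_of_sq (M N : Matrix ι ι ℝ) :
    (M * N).trace ≤ ((M.transpose * M).trace + (N.transpose * N).trace) / 2 := by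
  have h : 0 ≤ ((M - N.transpose).transpose * (M - N.transpose)).trace := by
    have := (Matrix.posSemidef_conjTranspose_mul_self (M - N.transpose)).trace_nonneg
    simpa using this
  have e : ((M - N.transpose).transpose * (M - N.transpose)).trace
      = (M.transpose * M).trace + (N.transpose * N).trace - 2 * (M * N).trace := by
    simp only [Matrix.transpose_sub, Matrix.transpose_transpose, sub_mul, mul_sub,
      Matrix.trace_sub]
    rw [Matrix.trace_mul_comm N N.transpose, Matrix.trace_mul_comm N M]
    have : (M.transpose * N.transpose).trace = (M * N).trace := by
      rw [← Matrix.transpose_mul, Matrix.trace_transpose, Matrix.trace_mul_comm]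
    rw [this]; ring
  linarith

variable [DecidableEq ι]

lemma trace_mul_pow_comm (M N : Matrix ι ι ℝ) (q : ℕ) :
    ((M * N) ^ q).trace = ((N * M) ^ q).trace := by
  cases q with
  | zero => simp
  | succ q =>
    have e : (M * N) ^ (q + 1) = M * ((N * M) ^ q * N) := by
      rw [pow_succ', mul_assoc M N]
      congr 1
      induction q with
      | zero => simp
      | succ q ih =>
        rw [pow_succ', mul_assoc M N, ih, pow_succ' (N * M)]
        simp only [mul_assoc]
    rw [e, Matrix.trace_mul_comm, pow_succ, mul_assoc]

/-- The two inequalities feed each other. At the next level, the second follows from the first for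
`P * Q` and cyclicity, which give the word `P² Q²`, and then the second for `P²`, `Q²`. The first
follows from the first for `M²`, whose Gram matrix is cyclically `(Mᵀ M)(M Mᵀ)`, then the second and
Cauchy–Schwarz, since `Mᵀ M` and `M Mᵀ` have equal power traces. -/
lemma trace_pow_le_and_trace_mul_pow_le (j : ℕ) :
    (∀ M : Matrix ι ι ℝ,
      (M ^ (2 * 2 ^ j)).trace ≤ ((M.transpose * M) ^ (2 ^ j)).trace) ∧
    (∀ P Q : Matrix ι ι ℝ, P.IsSymm → Q.IsSymm →
      ((P * Q) ^ (2 ^ j)).trace ≤ (P ^ (2 ^ j) * Q ^ (2 ^ j)).trace) := by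
  induction j with
  | zero =>
    refine ⟨fun M => ?_, fun P Q _ _ => by simp⟩
    have := trace_mul_le_of_sq M M
    simpa [sq] using this
  | succ j ih =>
    obtain ⟨hS, hT⟩ := ih
    have hT' : ∀ P Q : Matrix ι ι ℝ, P.IsSymm → Q.IsSymm →
        ((P * Q) ^ (2 ^ (j + 1))).trace ≤ (P ^ (2 ^ (j + 1)) * Q ^ (2 ^ (j + 1))).trace := by
      intro P Q hP hQ
      calc ((P * Q) ^ (2 ^ (j + 1))).trace = ((P * Q) ^ (2 * 2 ^ j)).trace := by
            rw [pow_succ']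
        _ ≤ (((P * Q).transpose * (P * Q)) ^ (2 ^ j)).trace := hS _
        _ = (((Q * (P ^ 2 * Q))) ^ (2 ^ j)).trace := by
            rw [Matrix.transpose_mul, hP.eq, hQ.eq, sq]; simp only [mul_assoc]
        _ = ((P ^ 2 * Q ^ 2) ^ (2 ^ j)).trace := by
            rw [trace_mul_pow_comm, mul_assoc, ← sq]
        _ ≤ ((P ^ 2) ^ (2 ^ j) * (Q ^ 2) ^ (2 ^ j)).trace := hT _ _ (hP.pow 2) (hQ.pow 2)
        _ = _ := by rw [← pow_mul, ← pow_mul, ← pow_succ']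
    refine ⟨fun M => ?_, hT'⟩
    have hP : (M.transpose * M).IsSymm := Matrix.isSymm_transpose_mul_self M
    have hQ : (M * M.transpose).IsSymm := Matrix.isSymm_mul_transpose_self M
    set P := M.transpose * M with hPdef
    set Q := M * M.transpose with hQdef
    set q := 2 ^ j with hq
    have e2 : 2 ^ (j + 1) = 2 * q := by rw [pow_succ']
    rw [e2] at hT' ⊢
    calc (M ^ (2 * (2 * q))).trace = ((M ^ 2) ^ (2 * q)).trace := by rw [← pow_mul]
      _ ≤ (((M ^ 2).transpose * (M ^ 2)) ^ q).trace := hS _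
      _ = ((M.transpose * (P * M)) ^ q).trace := by
          rw [sq, Matrix.transpose_mul, hPdef]; simp only [mul_assoc]
      _ = ((P * Q) ^ q).trace := by
          rw [trace_mul_pow_comm, mul_assoc]
      _ ≤ (P ^ q * Q ^ q).trace := hT P Q hP hQ
      _ ≤ (((P ^ q).transpose * P ^ q).trace + ((Q ^ q).transpose * Q ^ q).trace) / 2 :=
          trace_mul_le_of_sq _ _
      _ = ((P ^ (2 * q)).trace + (Q ^ (2 * q)).trace) / 2 := by
          rw [(hP.pow q).eq, (hQ.pow q).eq, ← pow_add, ← pow_add, two_mul]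
      _ = (P ^ (2 * q)).trace := by
          rw [hQdef, hPdef, trace_mul_pow_comm M]; ring

end Trace

/-- The Golden–Thompson inequality for real symmetric matrices. -/
theorem trace_exp_add_le {d : ℕ} {A B : Matrix (Fin d) (Fin d) ℝ} (hA : A.IsSymm)
    (hB : B.IsSymm) :
    (NormedSpace.exp (A + B)).trace ≤ (NormedSpace.exp A * NormedSpace.exp B).trace := by
  rcases Nat.eq_zero_or_pos d with rfl | hd
  · simp [Matrix.trace]
  have : NeZero d := ⟨hd.ne'⟩
  -- The trace inequality is available for exponents `2 ^ j` only, so the product formula is used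
  -- along powers of two.
  have hlim := (tendsto_exp_mul_exp_pow A B).comp (tendsto_pow_atTop_atTop_of_one_lt one_lt_two)
  have htr : Continuous fun M : Matrix (Fin d) (Fin d) ℝ => M.trace := continuous_id.matrix_trace
  refine le_of_tendsto ((htr.tendsto _).comp hlim) (Eventually.of_forall fun j => ?_)
  simp only [Function.comp]
  refine ((trace_pow_le_and_trace_mul_pow_le j).2 _ _ (hA.smul _).exp (hB.smul _).exp).trans
    (le_of_eq ?_)
  have e : ∀ M : Matrix (Fin d) (Fin d) ℝ,
      NormedSpace.exp ((((2 ^ j : ℕ) : ℝ)⁻¹) • M) ^ (2 ^ j) = NormedSpace.exp M := by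
    intro M
    rw [← Matrix.exp_nsmul, ← Nat.cast_smul_eq_nsmul ℝ, smul_smul, mul_inv_cancel₀ (by positivity),
      one_smul]
  rw [e, e]

/-! ### Inequalities for the matrix exponential -/

section Exp

variable {d : ℕ}

lemma one_add_le_exp {Y : Matrix (Fin d) (Fin d) ℝ} (hY : Y.IsHermitian) :
    1 + Y ≤ NormedSpace.exp Y := by
  have hs : IsSelfAdjoint Y := hY
  have h : cfc (fun x : ℝ => 1 + x) Y ≤ cfc Real.exp Y :=
    cfc_mono fun x _ => by linarith [Real.add_one_le_exp x]
  rwa [CFC.real_exp_eq_normedSpace_exp hs, cfc_const_add (1 : ℝ) (fun x => x) Y, cfc_id' ℝ Y,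
    map_one] at h

/-- The scalar inequality `exp x ≤ 1 + x + x²` holds for all `x ≤ 1`, with no lower bound; hence
increments need only be bounded from above. -/
lemma exp_le_one_add_add_sq {Z : Matrix (Fin d) (Fin d) ℝ} (hZ : Z.IsHermitian) (h1 : Z ≤ 1) :
    NormedSpace.exp Z ≤ 1 + Z + Z ^ 2 := by
  have hs : IsSelfAdjoint Z := hZ
  have hsp : ∀ x ∈ spectrum ℝ Z, x ≤ 1 := by
    have : Z ≤ algebraMap ℝ _ 1 := by simpa using h1
    exact (le_algebraMap_iff_spectrum_le hs).1 this
  have h : cfc Real.exp Z ≤ cfc (fun x : ℝ => (1 + x) + x ^ 2) Z := by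
    refine cfc_mono fun x hx => ?_
    have hx1 := hsp x hx
    by_cases h' : -1 ≤ x
    · have := Real.abs_exp_sub_one_sub_id_le (abs_le.2 ⟨h', hx1⟩)
      linarith [(abs_le.1 this).2]
    · push Not at h'
      have : Real.exp x ≤ 1 := Real.exp_le_one_iff.2 (by linarith)
      nlinarith
  rwa [CFC.real_exp_eq_normedSpace_exp hs, cfc_add (a := Z) (fun x : ℝ => 1 + x) (fun x => x ^ 2),
    cfc_const_add (1 : ℝ) (fun x => x) Z, cfc_id' ℝ Z, map_one, cfc_pow_id Z 2] at h

/-- With `P = S* S`, cyclicity turns the trace into that of the positive semidefinite matrix `S Q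
S*`. -/
lemma trace_mul_nonneg {P Q : Matrix (Fin d) (Fin d) ℝ} (hP : 0 ≤ P) (hQ : 0 ≤ Q) :
    0 ≤ (P * Q).trace := by
  obtain ⟨S, rfl⟩ := CStarAlgebra.nonneg_iff_eq_star_mul_self.1 hP
  rw [mul_assoc, Matrix.trace_mul_comm]
  have := star_right_conjugate_nonneg hQ S
  exact (Matrix.nonneg_iff_posSemidef.1 this).trace_nonneg

lemma trace_mul_le_trace_mul {P Q R : Matrix (Fin d) (Fin d) ℝ} (hP : 0 ≤ P) (h : Q ≤ R) :
    (P * Q).trace ≤ (P * R).trace := by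
  have := trace_mul_nonneg hP (sub_nonneg.2 h)
  rw [mul_sub, Matrix.trace_sub] at this
  linarith

lemma exp_nonneg_of_isHermitian {H : Matrix (Fin d) (Fin d) ℝ} (hH : H.IsHermitian) :
    0 ≤ NormedSpace.exp H :=
  IsSelfAdjoint.exp_nonneg hH

/-- The gradient inequality for the convex function `tr exp`. -/
theorem trace_exp_mul_one_add_le {H M : Matrix (Fin d) (Fin d) ℝ} (hH : H.IsHermitian)
    (hM : M.IsHermitian) :
    (NormedSpace.exp H * (1 + M)).trace ≤ (NormedSpace.exp (H + M)).trace := by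
  set U : Matrix (Fin d) (Fin d) ℝ := (hH.eigenvectorUnitary : Matrix (Fin d) (Fin d) ℝ)
  set a := hH.eigenvalues
  have hUU : star U * U = 1 := Unitary.coe_star_mul_self hH.eigenvectorUnitary
  have hUU' : U * star U = 1 := Unitary.coe_mul_star_self hH.eigenvectorUnitary
  have hUi : U⁻¹ = star U := Matrix.inv_eq_left_inv hUU
  have hUu : IsUnit U := (Unitary.toUnits hH.eigenvectorUnitary).isUnit
  have hHd : H = U * Matrix.diagonal a * U⁻¹ := by
    rw [hUi]
    have := hH.spectral_theorem
    rw [Unitary.conjStarAlgAut_apply] at this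
    simpa using this
  set C := star U * M * U with hC
  have hMc : M = U * C * U⁻¹ := by
    rw [hUi, hC]
    calc M = (U * star U) * M * (U * star U) := by rw [hUU']; simp
      _ = _ := by simp only [mul_assoc]
  have hCh : C.IsHermitian := by
    have := Matrix.isHermitian_conjTranspose_mul_mul U hM
    exact this
  have tr_conj : ∀ X : Matrix (Fin d) (Fin d) ℝ, (U * X * U⁻¹).trace = X.trace := by
    intro X
    rw [hUi, Matrix.trace_mul_comm, ← mul_assoc, hUU, one_mul]
  have e1 : (NormedSpace.exp H * (1 + M)).trace
      = (NormedSpace.exp (Matrix.diagonal a) * (1 + C)).trace := by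
    rw [← tr_conj (NormedSpace.exp (Matrix.diagonal a) * (1 + C))]
    congr 1
    have : NormedSpace.exp H = U * NormedSpace.exp (Matrix.diagonal a) * U⁻¹ := by
      rw [hHd]; exact Matrix.exp_conj U _ hUu
    rw [this, hMc, hUi]
    simp only [mul_add, mul_one, mul_assoc]
    rw [← mul_assoc (star U) U, hUU, one_mul]
    simp only [add_mul, mul_assoc]
  have e2 : (NormedSpace.exp (H + M)).trace = (NormedSpace.exp (Matrix.diagonal a + C)).trace := by
    rw [← tr_conj (NormedSpace.exp (Matrix.diagonal a + C)), ← Matrix.exp_conj U _ hUu]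
    congr 2
    rw [mul_add, add_mul, ← hMc, ← hHd]
  rw [e1, e2, Matrix.exp_diagonal]
  simp only [Matrix.trace, Matrix.diag, Matrix.diagonal_mul]
  refine Finset.sum_le_sum fun i _ => ?_
  -- In an eigenbasis of `H` it suffices to compare `i`-th diagonal entries. Shifting by the scalar
  -- `a i` factors out `exp (a i)`, and `1 + Y ≤ exp Y` is then read at the entry `(i, i)`, where `1
  -- + Y` equals `1 + C i i`.
  set Y := Matrix.diagonal a + C - a i • (1 : Matrix (Fin d) (Fin d) ℝ) with hY
  have hYh : Y.IsHermitian :=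
    ((Matrix.isHermitian_diagonal a).add hCh).sub (Matrix.isHermitian_one.smul (star_trivial (a i)))
  have e3 : NormedSpace.exp (Matrix.diagonal a + C)
      = Real.exp (a i) • NormedSpace.exp Y := by
    have : Matrix.diagonal a + C = a i • (1 : Matrix (Fin d) (Fin d) ℝ) + Y := by rw [hY]; abel
    rw [this, Matrix.exp_add_of_commute _ _ ((Commute.one_left Y).smul_left (a i)),
      ← Matrix.diagonal_one, ← Matrix.diagonal_smul, Matrix.exp_diagonal]
    have e4 : NormedSpace.exp (a i • fun _ : Fin d => (1 : ℝ)) = Real.exp (a i) • fun _ => 1 := by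
      ext j; simp [Real.exp_eq_exp_ℝ, NormedSpace.exp_def, Pi.coe_exp]
    rw [e4, Matrix.diagonal_smul, smul_mul_assoc]
    simp
  have h5 := (Matrix.le_iff.1 (one_add_le_exp hYh)).diag_nonneg (i := i)
  have h6 : (1 + Y) i i = 1 + C i i := by simp [hY]
  rw [Matrix.sub_apply, h6] at h5
  rw [e3, Matrix.smul_apply, smul_eq_mul]
  have e5 : NormedSpace.exp a i = Real.exp (a i) := by
    rw [Pi.coe_exp, Real.exp_eq_exp_ℝ]
  rw [e5]
  refine mul_le_mul_of_nonneg_left ?_ (Real.exp_nonneg _)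
  simpa using h5

/-- A one-step bound for the trace exponential: the increments `Z i` are centred, at most `1`, and
have total variance at most `M`. -/
theorem sum_trace_exp_add_le {ι : Type*} (s : Finset ι) (p : ι → ℝ) (hp : ∀ i ∈ s, 0 ≤ p i)
    (hp1 : ∑ i ∈ s, p i = 1) {H M : Matrix (Fin d) (Fin d) ℝ}
    (hH : H.IsHermitian) (hM : M.IsHermitian) (Z : ι → Matrix (Fin d) (Fin d) ℝ)
    (hZ : ∀ i ∈ s, (Z i).IsHermitian) (hZ1 : ∀ i ∈ s, p i ≠ 0 → Z i ≤ 1)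
    (hmean : ∑ i ∈ s, p i • Z i = 0)
    (hvar : ∑ i ∈ s, p i • (Z i) ^ 2 ≤ M) :
    ∑ i ∈ s, p i * (NormedSpace.exp (H + Z i)).trace ≤ (NormedSpace.exp (H + M)).trace := by
  have hE := exp_nonneg_of_isHermitian hH
  calc ∑ i ∈ s, p i * (NormedSpace.exp (H + Z i)).trace
      ≤ ∑ i ∈ s, p i * (NormedSpace.exp H * (1 + Z i + Z i ^ 2)).trace := by
        refine Finset.sum_le_sum fun i hi => ?_
        by_cases h0 : p i = 0
        · simp [h0]
        refine mul_le_mul_of_nonneg_left ?_ (hp i hi)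
        exact (trace_exp_add_le hH (hZ i hi)).trans
          (trace_mul_le_trace_mul hE (exp_le_one_add_add_sq (hZ i hi) (hZ1 i hi h0)))
    _ = (NormedSpace.exp H * (1 + ∑ i ∈ s, p i • (Z i) ^ 2)).trace := by
        have : ∀ i ∈ s, p i * (NormedSpace.exp H * (1 + Z i + Z i ^ 2)).trace
            = (NormedSpace.exp H * (p i • (1 : Matrix (Fin d) (Fin d) ℝ) + p i • Z i
              + p i • Z i ^ 2)).trace := by
          intro i _
          rw [← smul_add, ← smul_add, mul_smul_comm, Matrix.trace_smul, smul_eq_mul]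
        rw [Finset.sum_congr rfl this, ← Matrix.trace_sum, ← Finset.mul_sum,
          Finset.sum_add_distrib, Finset.sum_add_distrib, hmean, ← Finset.sum_smul, hp1, one_smul,
          add_zero]
    _ ≤ (NormedSpace.exp H * (1 + M)).trace := trace_mul_le_trace_mul hE (by gcongr)
    _ ≤ _ := trace_exp_mul_one_add_le hH hM

end Exp

/-! ### Squares of symmetric matrices in the Loewner order -/

section Squares

variable {d : ℕ}

lemma sq_nonneg_of_isHermitian {M : Matrix (Fin d) (Fin d) ℝ} (hM : M.IsHermitian) :
    0 ≤ M ^ 2 := by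
  have h := star_mul_self_nonneg M
  rwa [show star M = M from hM, ← sq] at h

lemma add_sq_le_two_smul {M N : Matrix (Fin d) (Fin d) ℝ} (hM : M.IsHermitian)
    (hN : N.IsHermitian) : (M + N) ^ 2 ≤ (2 : ℝ) • (M ^ 2 + N ^ 2) := by
  have h := sq_nonneg_of_isHermitian (hM.sub hN)
  rw [← sub_nonneg]
  convert h using 1
  rw [two_smul]; noncomm_ring

lemma isHermitian_sum_smul {ι : Type*} (s : Finset ι) (p : ι → ℝ)
    {M : ι → Matrix (Fin d) (Fin d) ℝ} (hM : ∀ i ∈ s, (M i).IsHermitian) :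
    (∑ i ∈ s, p i • M i).IsHermitian := by
  have h : IsSelfAdjoint (∑ i ∈ s, p i • M i) :=
    isSelfAdjoint_sum s fun i hi => (IsSelfAdjoint.all (p i)).smul (hM i hi)
  exact h

/-- Variance is second moment minus squared mean, for weights of arbitrary total `m`: the
probabilities `p i` sum to the number of unrevealed ones. -/
lemma sum_smul_sub_sq {ι : Type*} (s : Finset ι) (p : ι → ℝ) (M : ι → Matrix (Fin d) (Fin d) ℝ)
    (N : Matrix (Fin d) (Fin d) ℝ) {m : ℝ} (hp : ∑ i ∈ s, p i = m)
    (hN : ∑ i ∈ s, p i • M i = m • N) :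
    ∑ i ∈ s, p i • (M i - N) ^ 2 = ∑ i ∈ s, p i • (M i) ^ 2 - m • N ^ 2 := by
  have e : ∀ i ∈ s, p i • (M i - N) ^ 2
      = p i • (M i) ^ 2 - (p i • M i) * N - N * (p i • M i) + p i • N ^ 2 := by
    intro i _
    rw [smul_mul_assoc, mul_smul_comm, ← smul_sub, ← smul_sub, ← smul_add]
    congr 1
    noncomm_ring
  rw [Finset.sum_congr rfl e, Finset.sum_add_distrib, Finset.sum_sub_distrib,
    Finset.sum_sub_distrib, ← Finset.sum_mul, ← Finset.mul_sum, hN, ← Finset.sum_smul, hp,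
    smul_mul_assoc, mul_smul_comm, ← sq]
  abel

/-- The operator Jensen inequality for the square. -/
lemma sum_smul_sq_le {ι : Type*} (s : Finset ι) (p : ι → ℝ) (hp : ∀ i ∈ s, 0 ≤ p i)
    (hp1 : ∑ i ∈ s, p i = 1) (M : ι → Matrix (Fin d) (Fin d) ℝ)
    (hM : ∀ i ∈ s, (M i).IsHermitian) :
    (∑ i ∈ s, p i • M i) ^ 2 ≤ ∑ i ∈ s, p i • (M i) ^ 2 := by
  have h := sum_smul_sub_sq s p M _ hp1 (one_smul ℝ (∑ i ∈ s, p i • M i)).symm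
  rw [one_smul] at h
  rw [← sub_nonneg, ← h]
  exact Finset.sum_nonneg fun i hi =>
    smul_nonneg (hp i hi) (sq_nonneg_of_isHermitian ((hM i hi).sub (isHermitian_sum_smul s p hM)))

end Squares

/-! ### Conditional means on the cube -/

section Mean

variable {n : ℕ} {E : Type*} [AddCommGroup E] [Module ℝ E]

/-- The points of the cube equal to `1` on `T`. -/
def onesOn (T : Finset (Fin n)) : Finset (Fin n → Bool) :=
  Finset.univ.filter fun x => ∀ i ∈ T, x i = true

/-- The total weight of `onesOn T`. -/
def mass (w : (Fin n → Bool) → ℝ) (T : Finset (Fin n)) : ℝ := ∑ x ∈ onesOn T, w x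

/-- The `w`-average of `F` over `onesOn T`. -/
noncomputable def mean (w : (Fin n → Bool) → ℝ) (T : Finset (Fin n)) (F : (Fin n → Bool) → E) : E :=
  (mass w T)⁻¹ • ∑ x ∈ onesOn T, w x • F x

variable {w : (Fin n → Bool) → ℝ} {T : Finset (Fin n)} {F G : (Fin n → Bool) → E}

lemma mem_onesOn {x : Fin n → Bool} : x ∈ onesOn T ↔ ∀ i ∈ T, x i = true := by
  simp [onesOn]

lemma mean_add : mean w T (fun x => F x + G x) = mean w T F + mean w T G := by
  simp only [mean, smul_add, Finset.sum_add_distrib]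

lemma mean_smul (a : ℝ) : mean w T (fun x => a • F x) = a • mean w T F := by
  simp only [mean, Finset.smul_sum]
  refine Finset.sum_congr rfl fun x _ => ?_
  rw [smul_comm (w x) a, smul_comm _ a]

lemma mean_smul_const (φ : (Fin n → Bool) → ℝ) (v : E) :
    mean w T (fun x => φ x • v) = mean w T φ • v := by
  simp only [mean, smul_smul, smul_eq_mul, ← Finset.sum_smul]

lemma mean_sum {ι : Type*} (s : Finset ι) (F : ι → (Fin n → Bool) → E) :
    mean w T (fun x => ∑ i ∈ s, F i x) = ∑ i ∈ s, mean w T (F i) := by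
  simp only [mean, Finset.smul_sum]
  rw [Finset.sum_comm]

lemma mean_congr (h : ∀ x ∈ onesOn T, w x ≠ 0 → F x = G x) : mean w T F = mean w T G := by
  unfold mean
  congr 1
  refine Finset.sum_congr rfl fun x hx => ?_
  by_cases h0 : w x = 0
  · simp [h0]
  · rw [h x hx h0]

lemma mean_const (hT : mass w T ≠ 0) (v : E) : mean w T (fun _ => v) = v := by
  rw [mean, ← Finset.sum_smul, smul_smul]
  change ((mass w T)⁻¹ * mass w T) • v = v
  rw [inv_mul_cancel₀ hT, one_smul]

lemma mean_isHermitian {d : ℕ} {F : (Fin n → Bool) → Matrix (Fin d) (Fin d) ℝ}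
    (hF : ∀ x, (F x).IsHermitian) : (mean w T F).IsHermitian := by
  rw [mean, Finset.smul_sum]
  simp only [smul_smul]
  exact isHermitian_sum_smul _ _ fun x _ => hF x

lemma bit_nonneg (b : Bool) : 0 ≤ bit b := by cases b <;> simp [bit]

lemma mass_nonneg (hw : ∀ x, 0 ≤ w x) (T : Finset (Fin n)) : 0 ≤ mass w T :=
  Finset.sum_nonneg fun x _ => hw x

lemma sum_onesOn_bit_smul (i : Fin n) :
    ∑ x ∈ onesOn T, w x • (bit (x i) • F x) = ∑ x ∈ onesOn (insert i T), w x • F x := by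
  have e : onesOn (insert i T) = (onesOn T).filter fun x => x i = true := by
    ext x
    simp only [mem_onesOn, Finset.mem_filter, Finset.mem_insert, forall_eq_or_imp]
    tauto
  rw [e, Finset.sum_filter]
  refine Finset.sum_congr rfl fun x _ => ?_
  cases h : x i <;> simp [bit]

lemma mean_bit (i : Fin n) :
    mean w T (fun x => bit (x i)) = (mass w T)⁻¹ * mass w (insert i T) := by
  have h := sum_onesOn_bit_smul (w := w) (T := T) (F := fun _ => (1 : ℝ)) i
  simp only [smul_eq_mul, mul_one] at h
  simp only [mean, smul_eq_mul, h, mass]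

lemma mean_bit_nonneg (hw : ∀ x, 0 ≤ w x) (i : Fin n) : 0 ≤ mean w T (fun x => bit (x i)) := by
  rw [mean_bit]
  exact mul_nonneg (inv_nonneg.2 (mass_nonneg hw T)) (mass_nonneg hw _)

lemma mean_bit_smul (hw : ∀ x, 0 ≤ w x) (i : Fin n) :
    mean w T (fun x => bit (x i) • F x) = mean w T (fun x => bit (x i)) • mean w (insert i T) F := by
  rw [mean_bit, mean, mean, sum_onesOn_bit_smul, smul_smul]
  by_cases h : mass w (insert i T) = 0
  · have : ∑ x ∈ onesOn (insert i T), w x • F x = 0 := by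
      refine Finset.sum_eq_zero fun x hx => ?_
      rw [(Finset.sum_eq_zero_iff_of_nonneg fun x _ => hw x).1 h x hx, zero_smul]
    rw [this, smul_zero, smul_zero]
  · rw [mul_assoc, mul_inv_cancel₀ h, mul_one]

end Mean

/-! ### Swap couplings -/

section Swap

variable {n d : ℕ} {w : (Fin n → Bool) → ℝ} {T : Finset (Fin n)}

/-- The stochastic covering property of a homogeneous law, in terms of its weights: conditioning on
`x i = 1` instead of `x i = 0` amounts to moving a single one to the coordinate `i`. -/
def SwapCoupled (w : (Fin n → Bool) → ℝ) : Prop :=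
  ∀ (T : Finset (Fin n)) (i : Fin n), i ∉ T → 0 < mass w (insert i T) →
    mass w (insert i T) < mass w T →
    ∃ ν : (Fin n → Bool) × (Fin n → Bool) → ℝ, (∀ z, 0 ≤ ν z) ∧
      (∀ y, (mass w T - mass w (insert i T)) * ∑ q, ν (y, q) =
        if y ∈ onesOn T \ onesOn (insert i T) then w y else 0) ∧
      (∀ q, mass w (insert i T) * ∑ y, ν (y, q) = if q ∈ onesOn (insert i T) then w q else 0) ∧
      ∀ y q, ν (y, q) ≠ 0 → ∃ l, l ∉ insert i T ∧ q i = true ∧ q l = false ∧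
        y = xorBasis (xorBasis q i) l

/-- The contribution of the coordinates outside `T` to `∑ i, x i • S i`. -/
def restSum (S : Fin n → Matrix (Fin d) (Fin d) ℝ) (T : Finset (Fin n)) (x : Fin n → Bool) :
    Matrix (Fin d) (Fin d) ℝ :=
  ∑ i ∈ Tᶜ, bit (x i) • S i

lemma onesOn_insert_subset (i : Fin n) : onesOn (insert i T) ⊆ onesOn T := fun _ hx =>
  mem_onesOn.2 fun j hj => mem_onesOn.1 hx j (Finset.mem_insert_of_mem hj)

lemma mass_insert_le (hw : ∀ x, 0 ≤ w x) (i : Fin n) : mass w (insert i T) ≤ mass w T :=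
  Finset.sum_le_sum_of_subset_of_nonneg (onesOn_insert_subset i) fun x _ _ => hw x

/-! ### Increments of the sum over unrevealed ones -/

section RestSum

variable {S : Fin n → Matrix (Fin d) (Fin d) ℝ}

lemma restSum_isHermitian (hS : ∀ i, (S i).IsHermitian) (x : Fin n → Bool) :
    (restSum S T x).IsHermitian :=
  isHermitian_sum_smul _ _ fun i _ => hS i

lemma restSum_eq_insert {i : Fin n} (hi : i ∉ T) (x : Fin n → Bool) :
    restSum S T x = bit (x i) • S i + restSum S (insert i T) x := by
  unfold restSum
  have e : Tᶜ = insert i (insert i T)ᶜ := by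
    ext j; simp only [Finset.mem_compl, Finset.mem_insert]; by_cases h : j = i <;> simp [h, hi]
  rw [e, Finset.sum_insert (by simp)]

lemma restSum_xorBasis_of_mem {i : Fin n} (hi : i ∈ T) (x : Fin n → Bool) :
    restSum S T (xorBasis x i) = restSum S T x := by
  refine Finset.sum_congr rfl fun j hj => ?_
  have : j ≠ i := fun h => Finset.mem_compl.1 hj (h ▸ hi)
  simp [xorBasis, this]

lemma restSum_xorBasis {i : Fin n} (hi : i ∉ T) (x : Fin n → Bool) :
    restSum S T (xorBasis x i) = restSum S T x + (1 - 2 * bit (x i)) • S i := by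
  have e : bit (xorBasis x i i) = 1 - bit (x i) := by cases h : x i <;> simp [bit, xorBasis, h]
  rw [restSum_eq_insert hi, restSum_eq_insert hi x,
    restSum_xorBasis_of_mem (Finset.mem_insert_self i T), e]
  module

lemma restSum_sub_xorBasis_sq_le {ρ : ℝ} (hS : ∀ i, 0 ≤ S i) (hρ : 0 ≤ ρ)
    (hSS : ∀ i, S i ^ 2 ≤ ρ • S i) (i : Fin n) (x : Fin n → Bool) :
    (restSum S T x - restSum S T (xorBasis x i)) ^ 2 ≤ ρ • S i := by
  by_cases hi : i ∈ T
  · rw [restSum_xorBasis_of_mem hi, sub_self, zero_pow two_ne_zero]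
    exact smul_nonneg hρ (hS i)
  · have e : (restSum S T x - restSum S T (xorBasis x i)) ^ 2 = S i ^ 2 := by
      rw [restSum_xorBasis hi, sub_add_cancel_left, neg_sq, smul_pow]
      cases x i <;> norm_num [bit]
    rw [e]
    exact hSS i

/-- Once `i` is known to be a one, its term is the deterministic `S i`. This is the amount released
at each step of the exploration. -/
lemma mean_restSum_insert {i : Fin n} (hi : i ∉ T) (h : mass w (insert i T) ≠ 0) :
    mean w (insert i T) (restSum S T) = S i + mean w (insert i T) (restSum S (insert i T)) := by
  rw [← mean_const (w := w) h (S i), ← mean_add]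
  refine mean_congr fun x hx _ => ?_
  rw [restSum_eq_insert hi, mem_onesOn.1 hx i (Finset.mem_insert_self i T)]
  simp [bit]

end RestSum

lemma mean_insert_eq_of_mass_eq {E : Type*} [AddCommGroup E] [Module ℝ E] (hw : ∀ x, 0 ≤ w x)
    {i : Fin n} (h : mass w (insert i T) = mass w T) (F : (Fin n → Bool) → E) :
    mean w (insert i T) F = mean w T F := by
  unfold mean
  rw [h]
  congr 1
  refine Finset.sum_subset (onesOn_insert_subset i) fun x hx hx' => ?_
  have h0 : ∑ x ∈ onesOn T \ onesOn (insert i T), w x = 0 := by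
    have := Finset.sum_sdiff (f := w) (onesOn_insert_subset (T := T) i)
    unfold mass at h
    linarith
  rw [(Finset.sum_eq_zero_iff_of_nonneg fun x _ => hw x).1 h0 x (Finset.mem_sdiff.2 ⟨hx, hx'⟩),
    zero_smul]

/-- The effect of conditioning on `x i = 1` on the mean of a function with small increments. -/
lemma smul_sq_mean_insert_sub_mean_le (hw : ∀ x, 0 ≤ w x) (hsc : SwapCoupled w) {i : Fin n}
    (hT : 0 < mass w T) (hi : i ∉ T) {S : Fin n → Matrix (Fin d) (Fin d) ℝ} (hS : ∀ i, 0 ≤ S i)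
    {ρ K : ℝ} (hK : 0 ≤ K) (hρ : ∀ i, S i ≤ ρ • 1)
    {F : (Fin n → Bool) → Matrix (Fin d) (Fin d) ℝ} (hF : ∀ x, (F x).IsHermitian)
    (hFS : ∀ i x, (F x - F (xorBasis x i)) ^ 2 ≤ K • S i) :
    mean w T (fun x => bit (x i)) • (mean w (insert i T) F - mean w T F) ^ 2 ≤
      (2 * K) • ((2 : ℝ) • mean w T (fun x => bit (x i)) • S i
        + mean w T (fun x => bit (x i)) • mean w T (restSum S T)
        - mean w T (fun x => bit (x i) • restSum S T x)) ∧
    (0 < mass w (insert i T) →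
      (mean w (insert i T) F - mean w T F) ^ 2 ≤ (4 * K * ρ) • 1) := by
  have hK2 : 0 ≤ 2 * K := by positivity
  rw [mean_bit_smul hw]
  set p := mean w T (fun x => bit (x i)) with hp
  have hp' : p = (mass w T)⁻¹ * mass w (insert i T) := mean_bit i
  have hp0 : 0 ≤ p := mean_bit_nonneg hw i
  -- If `x i` is almost surely zero, the weight `p` vanishes; if it is almost surely one (the next
  -- case split), conditioning changes nothing. A swap coupling exists only strictly in between.
  rcases (mass_nonneg hw (insert i T)).eq_or_lt' with h0 | h0
  · have : p = 0 := by rw [hp', h0, mul_zero]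
    exact ⟨by simp [this], fun h => absurd h0 h.ne'⟩
  have h4 : (0 : Matrix (Fin d) (Fin d) ℝ) ≤ (4 * K * ρ) • 1 := by
    have : (4 * K * ρ) • (1 : Matrix (Fin d) (Fin d) ℝ) = (4 * K) • (ρ • 1) := by rw [smul_smul]
    rw [this]
    exact smul_nonneg (by positivity) ((hS i).trans (hρ i))
  rcases (mass_insert_le hw i).eq_or_lt with h1 | h1
  · rw [mean_insert_eq_of_mass_eq hw h1, mean_insert_eq_of_mass_eq hw h1, sub_self,
      zero_pow two_ne_zero, smul_zero]
    refine ⟨smul_nonneg hK2 ?_, fun _ => h4⟩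
    rw [add_sub_cancel_right]
    exact smul_nonneg zero_le_two (smul_nonneg hp0 (hS i))
  obtain ⟨ν, hν0, hν1, hν2, hν3⟩ := hsc T i hi h0 h1
  have hp1 : p ≤ 1 := by
    rw [hp', inv_mul_le_iff₀ hT, mul_one]; exact h1.le
  have hmean1 : ∀ {E : Type} [AddCommGroup E] [Module ℝ E] (G : (Fin n → Bool) → E),
      ∑ z, ν z • G z.2 = mean w (insert i T) G := by
    intro E _ _ G
    have : ∀ q, (∑ y, ν (y, q)) • G q
        = (mass w (insert i T))⁻¹ • if q ∈ onesOn (insert i T) then w q • G q else 0 := by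
      intro q
      rw [eq_inv_smul_iff₀ h0.ne', smul_smul, hν2]
      split_ifs <;> simp
    rw [Fintype.sum_prod_type_right]
    simp only [← Finset.sum_smul, this]
    rw [← Finset.smul_sum, mean, Finset.sum_ite_mem, Finset.univ_inter]
  -- The first marginal of `ν` is the law given `x i = 0`, whose mean is obtained from the law of
  -- total expectation.
  have hmean0 : ∀ {E : Type} [AddCommGroup E] [Module ℝ E] (G : (Fin n → Bool) → E),
      (1 - p) • ∑ z, ν z • G z.1 = mean w T G - p • mean w (insert i T) G := by
    intro E _ _ G
    have hd : mass w T - mass w (insert i T) ≠ 0 := by linarith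
    have : ∀ y, (∑ q, ν (y, q)) • G y = (mass w T - mass w (insert i T))⁻¹ •
        if y ∈ onesOn T \ onesOn (insert i T) then w y • G y else 0 := by
      intro q
      rw [eq_inv_smul_iff₀ hd, smul_smul, hν1]
      split_ifs <;> simp
    rw [Fintype.sum_prod_type]
    simp only [← Finset.sum_smul, this]
    have e : (1 - p) * (mass w T - mass w (insert i T))⁻¹ = (mass w T)⁻¹ := by
      rw [hp']; field_simp
    have e2 : p • mean w (insert i T) G
        = (mass w T)⁻¹ • ∑ x ∈ onesOn (insert i T), w x • G x := by
      rw [mean, hp', smul_smul, mul_assoc, mul_inv_cancel₀ h0.ne', mul_one]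
    rw [← Finset.smul_sum, smul_smul, e, Finset.sum_ite_mem, Finset.univ_inter, e2, mean,
      ← smul_sub, ← Finset.sum_sdiff (onesOn_insert_subset (T := T) i), add_sub_cancel_right]
  have hν : ∑ z, ν z = 1 := by
    have := hmean1 (fun _ => (1 : ℝ))
    rw [mean_const h0.ne'] at this
    simpa using this
  set g := restSum S T with hg
  set Δ := ∑ z, ν z • (F z.2 - F z.1) with hΔ
  set W := ∑ z, ν z • (g z.1 - g z.2 + (2 : ℝ) • S i) with hW
  have hstep : ∀ z, ν z • (F z.2 - F z.1) ^ 2 ≤ ν z • (2 * K) • (g z.1 - g z.2 + (2 : ℝ) • S i) ∧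
      ν z • (g z.1 - g z.2 + (2 : ℝ) • S i) ≤ ν z • (2 * ρ) • 1 := by
    rintro ⟨y, q⟩
    by_cases hz : ν (y, q) = 0
    · simp [hz]
    obtain ⟨l, hl, hqi, hql, rfl⟩ := hν3 y q hz
    rw [Finset.mem_insert, not_or] at hl
    have hxl : xorBasis q i l = false := by simp [xorBasis, hl.1, hql]
    -- The swap removes `S i` from `g` and adds `S l`. So the cost `S i + S l` is a difference of
    -- values of `g` plus a term depending on `i` alone, and the unknown `l` drops out after
    -- averaging.
    have e1 : g (xorBasis (xorBasis q i) l) - g q + (2 : ℝ) • S i = S i + S l := by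
      rw [hg, restSum_xorBasis hl.2, restSum_xorBasis hi, hxl, hqi]
      simp only [bit, if_true, Bool.false_eq_true, if_false]
      module
    dsimp only
    rw [e1]
    refine ⟨smul_le_smul_of_nonneg_left ?_ (hν0 _), smul_le_smul_of_nonneg_left ?_ (hν0 _)⟩
    · have e2 : F q - F (xorBasis (xorBasis q i) l)
          = (F q - F (xorBasis q i)) + (F (xorBasis q i) - F (xorBasis (xorBasis q i) l)) := by abel
      rw [e2]
      refine (add_sq_le_two_smul ((hF _).sub (hF _)) ((hF _).sub (hF _))).trans ?_
      refine (smul_le_smul_of_nonneg_left (add_le_add (hFS i _) (hFS l _)) zero_le_two).trans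
        (le_of_eq ?_)
      module
    · refine (add_le_add (hρ i) (hρ l)).trans (le_of_eq ?_)
      module
  have hΔW : Δ ^ 2 ≤ (2 * K) • W := by
    refine (sum_smul_sq_le _ _ (fun z _ => hν0 z) hν _ fun z _ => (hF _).sub (hF _)).trans ?_
    rw [hW, Finset.smul_sum]
    refine Finset.sum_le_sum fun z _ => ?_
    rw [smul_comm]
    exact (hstep z).1
  have hWρ : W ≤ (2 * ρ) • 1 := by
    refine (Finset.sum_le_sum fun z _ => (hstep z).2).trans (le_of_eq ?_)
    rw [← Finset.sum_smul, hν, one_smul]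
  have hΔ0 : 0 ≤ Δ ^ 2 :=
    sq_nonneg_of_isHermitian (isHermitian_sum_smul _ _ fun z _ => (hF _).sub (hF _))
  have hD : mean w (insert i T) F - mean w T F = (1 - p) • Δ := by
    have e : Δ = mean w (insert i T) F - ∑ z, ν z • F z.1 := by
      rw [hΔ, ← hmean1 F, ← Finset.sum_sub_distrib]
      exact Finset.sum_congr rfl fun z _ => smul_sub _ _ _
    rw [e, smul_sub, hmean0]
    module
  have hWg : (p * (1 - p)) • W = p • mean w T g - p • mean w (insert i T) g
      + (2 * (p * (1 - p))) • S i := by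
    have e : W = ∑ z, ν z • g z.1 - mean w (insert i T) g + (2 : ℝ) • S i := by
      rw [hW, ← hmean1 g, ← Finset.sum_sub_distrib]
      simp only [smul_add, Finset.sum_add_distrib, ← Finset.sum_smul, hν, one_smul, smul_sub]
    have e2 := hmean0 g
    rw [e, smul_add, smul_sub, mul_smul, e2]
    module
  rw [hD, smul_pow, smul_smul]
  constructor
  -- Only one factor `1 - p` is discarded: `p * (1 - p)` is the weight for which the mean of `W`
  -- becomes a difference of conditional means of `g`. The correction `-2 p² S i` is dropped at the
  -- end.
  · calc (p * (1 - p) ^ 2) • Δ ^ 2 ≤ (p * (1 - p)) • Δ ^ 2 := by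
          refine smul_le_smul_of_nonneg_right ?_ hΔ0
          nlinarith [mul_nonneg hp0 (sub_nonneg.2 hp1)]
      _ ≤ (p * (1 - p)) • (2 * K) • W :=
          smul_le_smul_of_nonneg_left hΔW (mul_nonneg hp0 (sub_nonneg.2 hp1))
      _ = (2 * K) • (p • mean w T g - p • mean w (insert i T) g + (2 * (p * (1 - p))) • S i) := by
          rw [smul_comm, hWg]
      _ ≤ _ := by
          refine smul_le_smul_of_nonneg_left ?_ hK2
          rw [← sub_nonneg]
          have : 0 ≤ (2 * p ^ 2) • S i := smul_nonneg (by positivity) (hS i)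
          refine this.trans (le_of_eq ?_)
          module
  · intro _
    calc (1 - p) ^ 2 • Δ ^ 2 ≤ (1 : ℝ) • Δ ^ 2 := by
          refine smul_le_smul_of_nonneg_right ?_ hΔ0
          nlinarith
      _ ≤ (2 * K) • W := by rwa [one_smul]
      _ ≤ (2 * K) • (2 * ρ) • 1 := smul_le_smul_of_nonneg_left hWρ hK2
      _ = _ := by rw [smul_smul]; congr 1; ring

end Swap

/-! ### The trace moment generating function -/

section Mgf

variable {n d : ℕ} {w : (Fin n → Bool) → ℝ} {T : Finset (Fin n)}

lemma sum_bit_compl {k m : ℕ} (hhom : ∀ x, w x ≠ 0 → ∑ i, bit (x i) = k) (hT : T.card + m = k)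
    {x : Fin n → Bool} (hx : x ∈ onesOn T) (hwx : w x ≠ 0) : ∑ i ∈ Tᶜ, bit (x i) = m := by
  have h := hhom x hwx
  rw [← Finset.sum_add_sum_compl T] at h
  have h1 : ∑ i ∈ T, bit (x i) = T.card := by
    rw [Finset.sum_congr rfl fun i hi => by rw [mem_onesOn.1 hx i hi]]
    simp [bit]
  rw [h1, ← hT] at h
  push_cast at h
  linarith

/-- Conditioning on a uniformly random one of `x` outside `T`. -/
lemma sum_mean_insert {E : Type*} [AddCommGroup E] [Module ℝ E] (hw : ∀ x, 0 ≤ w x) {k m : ℕ}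
    (hhom : ∀ x, w x ≠ 0 → ∑ i, bit (x i) = k) (hT : T.card + m = k) (G : (Fin n → Bool) → E) :
    ∑ i ∈ Tᶜ, mean w T (fun x => bit (x i)) • mean w (insert i T) G = (m : ℝ) • mean w T G := by
  simp only [← mean_bit_smul hw]
  rw [← mean_sum, ← mean_smul]
  refine mean_congr fun x hx hwx => ?_
  rw [← Finset.sum_smul, sum_bit_compl hhom hT hx hwx]

lemma sum_mean_bit {k m : ℕ} (hmass : mass w T ≠ 0)
    (hhom : ∀ x, w x ≠ 0 → ∑ i, bit (x i) = k) (hT : T.card + m = k) :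
    ∑ i ∈ Tᶜ, mean w T (fun x => bit (x i)) = m := by
  rw [← mean_sum, ← mean_const (w := w) hmass (m : ℝ)]
  exact mean_congr fun x hx hwx => sum_bit_compl hhom hT hx hwx

lemma mean_restSum (S : Fin n → Matrix (Fin d) (Fin d) ℝ) :
    mean w T (restSum S T) = ∑ i ∈ Tᶜ, mean w T (fun x => bit (x i)) • S i := by
  unfold restSum
  rw [mean_sum]
  exact Finset.sum_congr rfl fun i _ => mean_smul_const _ _

/-- The total variance of the increments of the conditional mean of `F` when a uniformly random
further one is revealed. -/
lemma sum_smul_sq_mean_insert_sub_mean_le (hw : ∀ x, 0 ≤ w x) (hsc : SwapCoupled w) {k m : ℕ}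
    (hhom : ∀ x, w x ≠ 0 → ∑ i, bit (x i) = k) (hTm : T.card + m = k) (hT : 0 < mass w T)
    {S : Fin n → Matrix (Fin d) (Fin d) ℝ} (hS : ∀ i, 0 ≤ S i) {ρ K : ℝ} (hK : 0 ≤ K)
    (hρ : ∀ i, S i ≤ ρ • 1) {F : (Fin n → Bool) → Matrix (Fin d) (Fin d) ℝ}
    (hF : ∀ x, (F x).IsHermitian) (hFS : ∀ i x, (F x - F (xorBasis x i)) ^ 2 ≤ K • S i) :
    ∑ i ∈ Tᶜ, mean w T (fun x => bit (x i)) • (mean w (insert i T) F - mean w T F) ^ 2 ≤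
      (4 * K) • mean w T (restSum S T) := by
  refine (Finset.sum_le_sum fun i hi => (smul_sq_mean_insert_sub_mean_le hw hsc hT
    (Finset.mem_compl.1 hi) hS hK hρ hF hFS).1).trans (le_of_eq ?_)
  simp only [mean_bit_smul hw]
  -- Summed over `i`, both `p i • mean w T g` and `p i • mean w (insert i T) g` give `m` times the
  -- mean of `g`, so they cancel. Only `2 ∑ p i • S i`, twice the mean of `g`, survives.
  rw [← Finset.smul_sum, Finset.sum_sub_distrib, Finset.sum_add_distrib,
    sum_mean_insert hw hhom hTm, ← Finset.sum_smul, sum_mean_bit hT.ne' hhom hTm, ← Finset.smul_sum,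
    ← mean_restSum]
  module

lemma sum_smul_sub_average_sq_le (hw : ∀ x, 0 ≤ w x) {k m : ℕ} (hm : 0 < m)
    (hhom : ∀ x, w x ≠ 0 → ∑ i, bit (x i) = k) (hTm : T.card + m = k) (hT : 0 < mass w T)
    {S : Fin n → Matrix (Fin d) (Fin d) ℝ} (hS : ∀ i, 0 ≤ S i) {ρ : ℝ}
    (hSS : ∀ i, S i ^ 2 ≤ ρ • S i) :
    ∑ i ∈ Tᶜ, mean w T (fun x => bit (x i)) • (S i - (m : ℝ)⁻¹ • mean w T (restSum S T)) ^ 2 ≤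
      ρ • mean w T (restSum S T) := by
  have hSh : ∀ i, (S i).IsHermitian := fun i => (Matrix.nonneg_iff_posSemidef.1 (hS i)).1
  have hm' : (m : ℝ) ≠ 0 := by positivity
  rw [sum_smul_sub_sq Tᶜ _ S ((m : ℝ)⁻¹ • mean w T (restSum S T)) (sum_mean_bit hT.ne' hhom hTm)
    (by rw [smul_smul, mul_inv_cancel₀ hm', one_smul, mean_restSum])]
  have hg : (mean w T (restSum S T)).IsHermitian := mean_isHermitian (restSum_isHermitian hSh)
  refine (sub_le_self _ (smul_nonneg (Nat.cast_nonneg m)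
    (sq_nonneg_of_isHermitian (hg.smul (star_trivial _))))).trans ?_
  rw [mean_restSum, Finset.smul_sum]
  refine Finset.sum_le_sum fun i _ => ?_
  rw [smul_comm]
  exact smul_le_smul_of_nonneg_left (hSS i) (mean_bit_nonneg hw i)

/-- When all `k` ones are located, homogeneity forces every other coordinate to vanish, so the
conditional law is a point mass. -/
lemma mean_eq_of_card_eq {E : Type*} [AddCommGroup E] [Module ℝ E] {k : ℕ}
    (hhom : ∀ x, w x ≠ 0 → ∑ i, bit (x i) = k) (hTk : T.card = k) (hT : mass w T ≠ 0)
    (G : (Fin n → Bool) → E) : mean w T G = G fun i => decide (i ∈ T) := by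
  rw [← mean_const (w := w) hT (G fun i => decide (i ∈ T))]
  refine mean_congr fun x hx hwx => ?_
  have h0 := sum_bit_compl (m := 0) hhom hTk hx hwx
  rw [Nat.cast_zero, Finset.sum_eq_zero_iff_of_nonneg fun i _ => bit_nonneg _] at h0
  congr 1
  ext i
  by_cases hi : i ∈ T
  · simp [hi, mem_onesOn.1 hx i hi]
  · have := h0 i (Finset.mem_compl.2 hi)
    cases h : x i
    · simp [hi]
    · simp [h, bit] at this

/-- Expanding `(D - 1/2)² ≥ 0` gives `D ≤ D² + 1/4`. The loss of `1/4` is harmless, since increments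
only have to stay below `1`. -/
lemma le_of_sq_le {D : Matrix (Fin d) (Fin d) ℝ} (hD : D.IsHermitian) {a : ℝ}
    (h : D ^ 2 ≤ a • 1) : D ≤ (a + 1 / 4) • 1 := by
  have h1 : 0 ≤ (D - (1 / 2 : ℝ) • 1) ^ 2 :=
    sq_nonneg_of_isHermitian (hD.sub (Matrix.isHermitian_one.smul (star_trivial _)))
  have e : (D - (1 / 2 : ℝ) • (1 : Matrix (Fin d) (Fin d) ℝ)) ^ 2
      = D ^ 2 - D + (1 / 4 : ℝ) • 1 := by
    simp only [sq, sub_mul, mul_sub, mul_smul_comm, smul_mul_assoc, mul_one, one_mul]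
    module
  rw [e] at h1
  have h2 : D ≤ D ^ 2 + (1 / 4 : ℝ) • 1 := by
    rw [← sub_nonneg]; refine h1.trans (le_of_eq ?_); abel
  rw [add_smul]
  exact h2.trans (by gcongr)

/-- A bound for the trace moment generating function of a homogeneous law with swap couplings, given
that the coordinates in `T` are ones; by induction on the number of ones not yet revealed. -/
theorem mean_trace_exp_le (hw : ∀ x, 0 ≤ w x) (hsc : SwapCoupled w) {k : ℕ}
    (hhom : ∀ x, w x ≠ 0 → ∑ i, bit (x i) = k)
    {S : Fin n → Matrix (Fin d) (Fin d) ℝ} (hS : ∀ i, 0 ≤ S i) {ρ : ℝ} (hρ0 : 0 ≤ ρ)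
    (hρ : ∀ i, S i ≤ ρ • 1) (hSS : ∀ i, S i ^ 2 ≤ ρ • S i)
    {f : (Fin n → Bool) → Matrix (Fin d) (Fin d) ℝ}
    (hf : ∀ x, (f x).IsHermitian) (hfS : ∀ i x, (f x - f (xorBasis x i)) ^ 2 ≤ S i)
    {θ : ℝ} (hθ : θ ^ 2 * ρ ≤ 1 / 1600) (m : ℕ) (T : Finset (Fin n)) (hTm : T.card + m = k)
    (hT : 0 < mass w T) {H : Matrix (Fin d) (Fin d) ℝ} (hH : H.IsHermitian) :
    mean w T (fun x => (NormedSpace.exp (H + θ • f x)).trace) ≤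
      (NormedSpace.exp (H + θ • mean w T f
        + (32 * θ ^ 2) • mean w T (restSum S T))).trace := by
  have hSh : ∀ i, (S i).IsHermitian := fun i => (Matrix.nonneg_iff_posSemidef.1 (hS i)).1
  have hsm : ∀ (a : ℝ) {M : Matrix (Fin d) (Fin d) ℝ}, M.IsHermitian → (a • M).IsHermitian :=
    fun a M hM => hM.smul (star_trivial a)
  induction m generalizing T H with
  | zero =>
    rw [mean_eq_of_card_eq hhom hTm hT.ne', mean_eq_of_card_eq hhom hTm hT.ne',
      mean_eq_of_card_eq hhom hTm hT.ne']
    have : restSum S T (fun i => decide (i ∈ T)) = 0 := by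
      refine Finset.sum_eq_zero fun i hi => ?_
      simp [Finset.mem_compl.1 hi, bit]
    rw [this, smul_zero, add_zero]
  | succ m ih =>
    set p : Fin n → ℝ := fun i => mean w T (fun x => bit (x i)) with hp
    have hp0 : ∀ i, 0 ≤ p i := mean_bit_nonneg hw
    set r : ℝ := ((m + 1 : ℕ) : ℝ) with hr
    have hr0 : 0 < r := by positivity
    set g := restSum S T with hg
    set Eg := mean w T g with hEg
    set N := r⁻¹ • Eg with hN
    set c : ℝ := 32 * θ ^ 2 with hc
    have hc0 : 0 ≤ c := by positivity
    -- The exponent supplied by the induction hypothesis after revealing `i` is `H + E F - c • S i`,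
    -- with the mean of this combined `F` taken given `insert i T`. So the increments of `f` and of
    -- the compensator are estimated together.
    set F : (Fin n → Bool) → Matrix (Fin d) (Fin d) ℝ := fun x => θ • f x + c • g x with hF
    have hgh : ∀ x, (g x).IsHermitian := restSum_isHermitian hSh
    have hFh : ∀ x, (F x).IsHermitian := fun x => (hsm _ (hf x)).add (hsm _ (hgh x))
    have hEgh : Eg.IsHermitian := mean_isHermitian hgh
    have hNh : N.IsHermitian := hsm _ hEgh
    -- Since `c² ρ = 1024 θ² (θ² ρ) ≤ 0.64 θ²`, the increments of `F` cost at most `2 (1 + 0.64) θ²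
    -- ≤ 3.5 θ²`.
    set K : ℝ := 7 / 2 * θ ^ 2 with hK
    have hK0 : 0 ≤ K := by positivity
    have hFS : ∀ i x, (F x - F (xorBasis x i)) ^ 2 ≤ K • S i := by
      intro i x
      have e : F x - F (xorBasis x i)
          = θ • (f x - f (xorBasis x i)) + c • (g x - g (xorBasis x i)) := by
        simp only [hF]; module
      rw [e]
      refine (add_sq_le_two_smul (hsm _ ((hf _).sub (hf _)))
        (hsm _ ((hgh _).sub (hgh _)))).trans ?_
      rw [smul_pow, smul_pow]
      calc (2 : ℝ) • (θ ^ 2 • (f x - f (xorBasis x i)) ^ 2 + c ^ 2 • (g x - g (xorBasis x i)) ^ 2)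
          ≤ (2 : ℝ) • (θ ^ 2 • S i + c ^ 2 • ρ • S i) := by
            refine smul_le_smul_of_nonneg_left (add_le_add ?_ ?_) zero_le_two
            · exact smul_le_smul_of_nonneg_left (hfS i x) (sq_nonneg θ)
            · exact smul_le_smul_of_nonneg_left (restSum_sub_xorBasis_sq_le hS hρ0 hSS i x)
                (sq_nonneg c)
        _ = (2 * (θ ^ 2 + c ^ 2 * ρ)) • S i := by module
        _ ≤ K • S i := by
            refine smul_le_smul_of_nonneg_right ?_ (hS i)
            have : c ^ 2 * ρ = 1024 * (θ ^ 2 * (θ ^ 2 * ρ)) := by rw [hc]; ring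
            rw [this, hK]
            nlinarith [mul_le_mul_of_nonneg_left hθ (sq_nonneg θ)]
    set D : Fin n → Matrix (Fin d) (Fin d) ℝ := fun i => mean w (insert i T) F - mean w T F with hD
    have hDh : ∀ i, (D i).IsHermitian := fun i =>
      (mean_isHermitian hFh).sub (mean_isHermitian hFh)
    -- The released `S i` is centred by its average `N`; the constant part `c • N` is the variance
    -- budget of this step, lent to `H'` below.
    set Z : Fin n → Matrix (Fin d) (Fin d) ℝ := fun i => D i + (-c) • (S i - N) with hZ
    have hZh : ∀ i, (Z i).IsHermitian := fun i => (hDh i).add (hsm _ ((hSh i).sub hNh))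
    have hps : ∑ i ∈ Tᶜ, p i = r := sum_mean_bit hT.ne' hhom hTm
    have hpS : ∑ i ∈ Tᶜ, p i • S i = Eg := (mean_restSum S).symm
    have hpmass : ∀ i, p i ≠ 0 → 0 < mass w (insert i T) := by
      intro i hi
      refine (mass_nonneg hw _).lt_of_ne' fun h => hi ?_
      simp only [hp, mean_bit, h, mul_zero]
    have hEg1 : N ≤ ρ • 1 := by
      have : Eg ≤ r • ρ • 1 := by
        rw [← hpS, ← hps, Finset.sum_smul]
        exact Finset.sum_le_sum fun i _ => smul_le_smul_of_nonneg_left (hρ i) (hp0 i)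
      calc N ≤ r⁻¹ • r • ρ • 1 := smul_le_smul_of_nonneg_left this (by positivity)
        _ = ρ • 1 := by rw [smul_smul, inv_mul_cancel₀ hr0.ne', one_smul]
    have hZ1 : ∀ i ∈ Tᶜ, r⁻¹ * p i ≠ 0 → Z i ≤ 1 := by
      intro i hi hpi
      have hD1 := le_of_sq_le (hDh i) ((smul_sq_mean_insert_sub_mean_le hw hsc hT
        (Finset.mem_compl.1 hi) hS hK0 hρ hFh hFS).2 (hpmass i (right_ne_zero_of_mul hpi)))
      calc Z i = D i + c • N - c • S i := by simp only [hZ]; module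
        -- The negative term needs no bound, as only an upper bound on `Z i` is required.
        _ ≤ D i + c • N := sub_le_self _ (smul_nonneg hc0 (hS i))
        _ ≤ (4 * K * ρ + 1 / 4) • 1 + c • ρ • 1 :=
            add_le_add hD1 (smul_le_smul_of_nonneg_left hEg1 hc0)
        _ = (4 * K * ρ + 1 / 4 + c * ρ) • (1 : Matrix (Fin d) (Fin d) ℝ) := by module
        _ ≤ (1 : ℝ) • 1 := by
            refine smul_le_smul_of_nonneg_right ?_ (Matrix.nonneg_iff_posSemidef.2 .one)
            rw [hK, hc]; linarith
        _ = 1 := one_smul _ _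
    have hmean : ∑ i ∈ Tᶜ, (r⁻¹ * p i) • Z i = 0 := by
      have h1 : ∑ i ∈ Tᶜ, p i • mean w (insert i T) F = r • mean w T F :=
        sum_mean_insert hw hhom hTm F
      have h2 : ∑ i ∈ Tᶜ, p i • Z i = 0 := by
        simp only [hZ, hD, smul_add, smul_sub, smul_comm (p _) (-c), Finset.sum_add_distrib,
          Finset.sum_sub_distrib, ← Finset.smul_sum, ← Finset.sum_smul, h1, hpS, hps]
        rw [hN, smul_smul r, mul_inv_cancel₀ hr0.ne']
        module
      simp only [mul_smul, ← Finset.smul_sum, h2, smul_zero]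
    have hvar : ∑ i ∈ Tᶜ, (r⁻¹ * p i) • (Z i) ^ 2 ≤ c • N := by
      have h1 : ∑ i ∈ Tᶜ, p i • D i ^ 2 ≤ (4 * K) • Eg :=
        sum_smul_sq_mean_insert_sub_mean_le hw hsc hhom hTm hT hS hK0 hρ hFh hFS
      have h2 : ∑ i ∈ Tᶜ, p i • (S i - N) ^ 2 ≤ ρ • Eg :=
        sum_smul_sub_average_sq_le hw m.succ_pos hhom hTm hT hS hSS
      have hEg0 : 0 ≤ Eg := by
        rw [← hpS]; exact Finset.sum_nonneg fun i _ => smul_nonneg (hp0 i) (hS i)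
      have h3 : ∑ i ∈ Tᶜ, p i • Z i ^ 2 ≤ c • Eg := by
        calc ∑ i ∈ Tᶜ, p i • Z i ^ 2
            ≤ ∑ i ∈ Tᶜ, p i • (2 : ℝ) • (D i ^ 2 + c ^ 2 • (S i - N) ^ 2) := by
              refine Finset.sum_le_sum fun i _ => smul_le_smul_of_nonneg_left ?_ (hp0 i)
              have := add_sq_le_two_smul (hDh i) (hsm (-c) ((hSh i).sub hNh))
              rwa [smul_pow, neg_sq] at this
          _ = (2 : ℝ) • (∑ i ∈ Tᶜ, p i • D i ^ 2 + c ^ 2 • ∑ i ∈ Tᶜ, p i • (S i - N) ^ 2) := by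
              rw [Finset.smul_sum, ← Finset.sum_add_distrib, Finset.smul_sum]
              refine Finset.sum_congr rfl fun i _ => ?_
              module
          _ ≤ (2 : ℝ) • ((4 * K) • Eg + c ^ 2 • ρ • Eg) :=
              smul_le_smul_of_nonneg_left
                (add_le_add h1 (smul_le_smul_of_nonneg_left h2 (sq_nonneg c))) zero_le_two
          _ = (2 * (4 * K + c ^ 2 * ρ)) • Eg := by module
          -- This closes the induction: `2 (4 K + c² ρ) ≤ 2 (14 + 0.64) θ² ≤ 32 θ² = c`.
          _ ≤ c • Eg := by
              refine smul_le_smul_of_nonneg_right ?_ hEg0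
              have : c ^ 2 * ρ = 1024 * (θ ^ 2 * (θ ^ 2 * ρ)) := by rw [hc]; ring
              rw [this, hK, hc]
              nlinarith [mul_le_mul_of_nonneg_left hθ (sq_nonneg θ)]
      simp only [mul_smul, ← Finset.smul_sum]
      calc r⁻¹ • ∑ i ∈ Tᶜ, p i • Z i ^ 2 ≤ r⁻¹ • c • Eg :=
            smul_le_smul_of_nonneg_left h3 (by positivity)
        _ = c • N := smul_comm _ _ _
    set H' := H + θ • mean w T f + c • Eg - c • N with hH'
    have hH'h : H'.IsHermitian :=
      ((hH.add (hsm _ (mean_isHermitian hf))).add (hsm _ hEgh)).sub (hsm _ hNh)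
    have hstep := sum_trace_exp_add_le Tᶜ (fun i => r⁻¹ * p i)
      (fun i _ => mul_nonneg (by positivity) (hp0 i))
      (by rw [← Finset.mul_sum, hps, inv_mul_cancel₀ hr0.ne']) hH'h (hsm c hNh) Z
      (fun i _ => hZh i) hZ1 hmean hvar
    rw [hH', sub_add_cancel] at hstep
    refine le_trans ?_ hstep
    have hdec : mean w T (fun x => (NormedSpace.exp (H + θ • f x)).trace)
        = ∑ i ∈ Tᶜ, (r⁻¹ * p i) *
          mean w (insert i T) (fun x => (NormedSpace.exp (H + θ • f x)).trace) := by
      have h1 := sum_mean_insert hw hhom hTm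
        (fun x => (NormedSpace.exp (H + θ • f x)).trace)
      simp only [smul_eq_mul] at h1
      simp only [mul_assoc, ← Finset.mul_sum]
      rw [h1, ← mul_assoc, inv_mul_cancel₀ hr0.ne', one_mul]
    rw [hdec]
    refine Finset.sum_le_sum fun i hi => ?_
    by_cases hpi : p i = 0
    · simp [hpi]
    have hi' := Finset.mem_compl.1 hi
    refine mul_le_mul_of_nonneg_left ?_ (mul_nonneg (by positivity) (hp0 i))
    refine (ih (insert i T) (by rw [Finset.card_insert_of_notMem hi']; omega)
      (hpmass i hpi) hH).trans (le_of_eq ?_)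
    congr 2
    have e := mean_restSum_insert (S := S) hi' (hpmass i hpi).ne'
    have eF : ∀ T', mean w T' F = θ • mean w T' f + c • mean w T' g := fun T' => by
      rw [hF, mean_add, mean_smul, mean_smul]
    simp only [hZ, hD, eF, ← hg] at e ⊢
    rw [e, ← hEg]
    module

end Mgf

/-! ### From the stochastic covering property to swap couplings -/

section Coupling

variable {n : ℕ}

lemma mass_real (μ : Measure (Fin n → Bool)) [IsFiniteMeasure μ] (T : Finset (Fin n)) :
    mass (fun x => μ.real {x}) T = μ.real (onesOn T) :=
  sum_measureReal_singleton _

/-- A point of the cube from its coordinates outside `Λ` and a reference point on `Λ`. -/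
def glue (Λ : Finset (Fin n)) (x : Fin n → Bool) (a : (i : (Λᶜ : Finset (Fin n))) → Bool) :
    Fin n → Bool :=
  fun j => if h : j ∈ Λᶜ then a ⟨j, h⟩ else x j

lemma glue_restrict {Λ : Finset (Fin n)} {x z : Fin n → Bool} (hz : z ∈ agreeOn Λ x) :
    glue Λ x ((Λᶜ).restrict z) = z := by
  ext j
  by_cases hj : j ∈ Λᶜ
  · simp [glue, hj]
  · have hj' : j ∈ Λ := by simpa using hj
    have := congrFun hz ⟨j, hj'⟩
    simp only [Finset.restrict] at this
    simp [glue, hj', this]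

lemma map_glue_condLaw (μ : Measure (Fin n → Bool)) [IsFiniteMeasure μ] (Λ : Finset (Fin n))
    (x : Fin n → Bool) :
    (condLaw μ Λ x).map (glue Λ x) = ProbabilityTheory.cond μ (agreeOn Λ x) := by
  rw [condLaw, Measure.map_map (measurable_of_countable _) (measurable_of_countable _)]
  conv_rhs => rw [← Measure.map_id (μ := ProbabilityTheory.cond μ (agreeOn Λ x))]
  refine Measure.map_congr ?_
  have hm : MeasurableSet (agreeOn Λ x) := Set.Finite.measurableSet (Set.toFinite _)
  filter_upwards [ProbabilityTheory.ae_cond_mem hm] with z hz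
  exact glue_restrict hz

lemma cond_real_singleton (μ : Measure (Fin n → Bool)) [IsFiniteMeasure μ]
    (A : Finset (Fin n → Bool)) (hA : 0 < μ.real A) (y : Fin n → Bool) :
    μ.real A * (ProbabilityTheory.cond μ A).real {y} = if y ∈ A then μ.real {y} else 0 := by
  rw [measureReal_def (ProbabilityTheory.cond μ A),
    ProbabilityTheory.cond_apply A.measurableSet, ENNReal.toReal_mul, ENNReal.toReal_inv,
    ← measureReal_def, ← measureReal_def, ← mul_assoc, mul_inv_cancel₀ hA.ne',
    one_mul]
  split_ifs with h
  · congr 1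
    ext z; simp only [Set.mem_inter_iff, Finset.mem_coe, Set.mem_singleton_iff]
    constructor
    · exact fun h => h.2
    · rintro rfl; exact ⟨h, rfl⟩
  · have : (A : Set (Fin n → Bool)) ∩ {y} = ∅ := by
      ext z; simp only [Set.mem_inter_iff, Finset.mem_coe, Set.mem_singleton_iff,
        Set.mem_empty_iff_false, iff_false, not_and]
      rintro hz rfl; exact h hz
    rw [this, measureReal_empty]

lemma agreeOn_insert_decide_insert (T : Finset (Fin n)) (i : Fin n) :
    agreeOn (insert i T) (fun j => decide (j ∈ insert i T)) = onesOn (insert i T) := by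
  ext z
  simp only [agreeOn, Set.mem_ofPred_eq, funext_iff, Finset.restrict, Subtype.forall,
    Finset.mem_coe, mem_onesOn]
  refine forall₂_congr fun j hj => ?_
  simp [hj]

lemma agreeOn_insert_decide {T : Finset (Fin n)} {i : Fin n} (hi : i ∉ T) :
    agreeOn (insert i T) (fun j => decide (j ∈ T))
      = (onesOn T \ onesOn (insert i T) : Finset (Fin n → Bool)) := by
  ext z
  have e : z ∈ agreeOn (insert i T) (fun j => decide (j ∈ T)) ↔
      ∀ j ∈ insert i T, z j = decide (j ∈ T) := by
    simp only [agreeOn, Set.mem_ofPred_eq, funext_iff, Finset.restrict, Subtype.forall]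
  rw [e, Finset.forall_mem_insert, Finset.mem_coe, Finset.mem_sdiff, mem_onesOn, mem_onesOn,
    Finset.forall_mem_insert]
  constructor
  · rintro ⟨h1, h2⟩
    exact ⟨fun j hj => by simpa [hj] using h2 j hj, fun h => by simp [h1, hi] at h⟩
  · rintro ⟨h1, h2⟩
    refine ⟨?_, fun j hj => by simp [hj, h1 j hj]⟩
    by_contra h
    exact h2 ⟨by simpa [hi] using h, h1⟩

/-- Apply the covering property on `Λ = insert i T` to the patterns with all ones and with a zero
only at `i`. Outside `Λ`, the vector conditioned on the zero covers the other one. Both have `k`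
ones in total, so the covering cannot be an equality: exactly one extra one appears, at some `l`
outside `Λ`. -/
theorem StochasticCovering.swapCoupled {k : ℕ} {μ : Measure (Fin n → Bool)} [IsFiniteMeasure μ]
    (hscp : StochasticCovering μ) (hhom : ∀ x, μ.real {x} ≠ 0 → ∑ i, bit (x i) = k) :
    SwapCoupled fun x => μ.real {x} := by
  classical
  intro T i hi h1 h0
  set Λ := insert i T with hΛ
  set u : Fin n → Bool := fun j => decide (j ∈ Λ) with hu
  set v : Fin n → Bool := fun j => decide (j ∈ T) with hv
  have hAu : agreeOn Λ u = onesOn Λ := agreeOn_insert_decide_insert T i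
  have hAv : agreeOn Λ v = (onesOn T \ onesOn Λ : Finset (Fin n → Bool)) := agreeOn_insert_decide hi
  rw [mass_real] at h1
  have hm0 : mass (fun x => μ.real {x}) T - mass (fun x => μ.real {x}) Λ
      = μ.real (onesOn T \ onesOn Λ : Finset (Fin n → Bool)) := by
    rw [← sum_measureReal_singleton, mass, mass, sub_eq_iff_eq_add]
    exact (Finset.sum_sdiff (onesOn_insert_subset i)).symm
  have h0' : 0 < μ.real (onesOn T \ onesOn Λ : Finset (Fin n → Bool)) := by
    rw [← hm0]; linarith
  have hpos : ∀ A : Finset (Fin n → Bool), 0 < μ.real A → 0 < μ A := fun A hA =>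
    pos_iff_ne_zero.2 fun h => by simp [Measure.real, h] at hA
  have hcov : Covers (Λ.restrict u) (Λ.restrict v) := by
    refine Or.inr ⟨⟨i, Finset.mem_insert_self i T⟩, by simp [hv, hi], by simp [hu, hΛ], ?_⟩
    rintro ⟨j, hj⟩ hne
    have hji : j ≠ i := fun h => hne (Subtype.ext h)
    simp [hu, hv, hΛ, hji]
  obtain ⟨π, hπ1, hπ2, hπ3⟩ := hscp Λ u v (by rw [hAu]; exact hpos _ h1)
    (by rw [hAv]; exact hpos _ h0') hcov
  have hcp : IsProbabilityMeasure (condLaw μ Λ v) := by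
    have : IsProbabilityMeasure (ProbabilityTheory.cond μ (agreeOn Λ v)) :=
      ProbabilityTheory.cond_isProbabilityMeasure (by rw [hAv]; exact (hpos _ h0').ne')
    exact Measure.isProbabilityMeasure_map (measurable_of_countable _).aemeasurable
  -- The coupling is given only through its marginals; its finiteness is inherited from the first
  -- one.
  have hπp : IsFiniteMeasure π := by
    constructor
    have : π.map Prod.fst Set.univ < ∞ := by rw [hπ1]; exact measure_lt_top _ _
    rwa [Measure.map_apply measurable_fst MeasurableSet.univ, Set.preimage_univ] at this
  set G := Prod.map (glue Λ v) (glue Λ u) with hG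
  have hGm : Measurable G := measurable_of_countable _
  set σ := π.map G with hσ
  have hσ1 : σ.map Prod.fst = ProbabilityTheory.cond μ (agreeOn Λ v) := by
    rw [hσ, Measure.map_map measurable_fst hGm, ← map_glue_condLaw, ← hπ1,
      Measure.map_map (measurable_of_countable _) measurable_fst]
    rfl
  have hσ2 : σ.map Prod.snd = ProbabilityTheory.cond μ (agreeOn Λ u) := by
    rw [hσ, Measure.map_map measurable_snd hGm, ← map_glue_condLaw, ← hπ2,
      Measure.map_map (measurable_of_countable _) measurable_snd]
    rfl
  have hσf : IsFiniteMeasure σ := Measure.isFiniteMeasure_map _ _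
  have hs1 : ∀ y, ∑ q, σ.real {(y, q)} = (ProbabilityTheory.cond μ (agreeOn Λ v)).real {y} := by
    intro y
    rw [← hσ1, map_measureReal_apply measurable_fst (measurableSet_singleton y)]
    have : (Prod.fst ⁻¹' {y} : Set ((Fin n → Bool) × (Fin n → Bool)))
        = ((Finset.univ.map ⟨fun q : Fin n → Bool => (y, q), Prod.mk_right_injective y⟩ :
          Finset ((Fin n → Bool) × (Fin n → Bool))) : Set _) := by
      ext ⟨a, b⟩; simp [eq_comm]
    rw [this, ← sum_measureReal_singleton, Finset.sum_map]
    rfl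
  have hs2 : ∀ q, ∑ y, σ.real {(y, q)} = (ProbabilityTheory.cond μ (agreeOn Λ u)).real {q} := by
    intro q
    rw [← hσ2, map_measureReal_apply measurable_snd (measurableSet_singleton q)]
    have : (Prod.snd ⁻¹' {q} : Set ((Fin n → Bool) × (Fin n → Bool)))
        = ((Finset.univ.map ⟨fun y : Fin n → Bool => (y, q), Prod.mk_left_injective q⟩ :
          Finset ((Fin n → Bool) × (Fin n → Bool))) : Set _) := by
      ext ⟨a, b⟩; simp [eq_comm]
    rw [this, ← sum_measureReal_singleton, Finset.sum_map]
    rfl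
  have hm1 : ∀ y, (mass (fun x => μ.real {x}) T - mass (fun x => μ.real {x}) Λ)
      * ∑ q, σ.real {(y, q)} = if y ∈ onesOn T \ onesOn Λ then μ.real {y} else 0 := by
    intro y
    rw [hs1, hAv, hm0, cond_real_singleton μ _ h0']
  have hm2 : ∀ q, mass (fun x => μ.real {x}) Λ * ∑ y, σ.real {(y, q)}
      = if q ∈ onesOn Λ then μ.real {q} else 0 := by
    intro q
    rw [hs2, hAu, mass_real, cond_real_singleton μ _ h1]
  refine ⟨fun z => σ.real {z}, fun _ => measureReal_nonneg, hm1, hm2, fun y q hyq => ?_⟩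
  have hyq' : 0 < σ.real {(y, q)} := lt_of_le_of_ne measureReal_nonneg (Ne.symm hyq)
  have hy : y ∈ onesOn T \ onesOn Λ ∧ μ.real {y} ≠ 0 := by
    have : 0 < ∑ q, σ.real {(y, q)} :=
      Finset.sum_pos' (fun _ _ => measureReal_nonneg) ⟨q, Finset.mem_univ q, hyq'⟩
    have := mul_pos (hm0 ▸ h0') this
    rw [hm1] at this
    split_ifs at this with h
    · exact ⟨h, this.ne'⟩
    · exact absurd this (lt_irrefl 0)
  have hq : q ∈ onesOn Λ ∧ μ.real {q} ≠ 0 := by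
    have : 0 < ∑ y, σ.real {(y, q)} :=
      Finset.sum_pos' (fun _ _ => measureReal_nonneg) ⟨y, Finset.mem_univ y, hyq'⟩
    have := mul_pos h1 this
    rw [← mass_real, hm2] at this
    split_ifs at this with h
    · exact ⟨h, this.ne'⟩
    · exact absurd this (lt_irrefl 0)
  -- An atom of positive mass must come from a pair satisfying the covering relation, which holds
  -- `π`-almost surely.
  obtain ⟨a, b, hab, rfl, rfl⟩ : ∃ a b, Covers a b ∧ glue Λ v a = y ∧ glue Λ u b = q := by
    by_contra hcon
    push Not at hcon
    refine hyq ?_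
    change σ.real {(y, q)} = 0
    rw [hσ, map_measureReal_apply hGm (measurableSet_singleton _), measureReal_eq_zero_iff]
    refine measure_mono_null ?_ (ae_iff.1 hπ3)
    rintro ⟨a, b⟩ hp hc
    have hp' : glue Λ v a = y ∧ glue Λ u b = q := by simpa [hG] using hp
    exact hcon a b hc hp'.1 hp'.2
  have hqi : glue Λ u b i = true := mem_onesOn.1 hq.1 i (Finset.mem_insert_self i T)
  have hyi : glue Λ v a i = false := by simp [glue, hΛ, hv, hi]
  have hoff : ∀ j, j ∈ Λ → j ≠ i → glue Λ v a j = glue Λ u b j := by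
    intro j hj hji
    have hjT : j ∈ T := (Finset.mem_insert.1 hj).resolve_left hji
    simp [glue, hj, hu, hv, hjT]
  rcases hab with rfl | ⟨⟨l, hl⟩, hbl, hal, hrest⟩
  -- If the parts outside `Λ` agreed, the two points would differ only at `i`, and their numbers of
  -- ones would differ by one, against homogeneity.
  · exfalso
    have e : ∑ j, (bit (glue Λ u a j) - bit (glue Λ v a j)) = 1 := by
      rw [Finset.sum_eq_single i]
      · rw [hqi, hyi]; simp [bit]
      · intro j _ hji
        by_cases hj : j ∈ Λ
        · rw [hoff j hj hji, sub_self]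
        · simp [glue, hj]
      · simp
    rw [Finset.sum_sub_distrib, hhom _ hq.2, hhom _ hy.2] at e
    simp at e
  · have hlΛ : l ∉ Λ := Finset.mem_compl.1 hl
    have hli : l ≠ i := fun h => hlΛ (h ▸ Finset.mem_insert_self i T)
    refine ⟨l, hlΛ, hqi, by simp [glue, hlΛ, hbl], ?_⟩
    ext j
    rcases eq_or_ne j i with rfl | hji
    · rw [hyi]; simp [xorBasis, hqi, hli.symm]
    rcases eq_or_ne j l with rfl | hjl
    · simp [xorBasis, hji, glue, hlΛ, hbl, hal]
    simp only [xorBasis, hji, hjl, decide_false, Bool.xor_false]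
    by_cases hj : j ∈ Λ
    · exact hoff j hj hji
    · have := hrest ⟨j, Finset.mem_compl.2 hj⟩ (fun h => hjl (congrArg Subtype.val h))
      simp [glue, hj, this]

end Coupling

/-! ### Spectral bounds -/

section Spectral

variable {d : ℕ}

lemma trace_exp_smul {M : Matrix (Fin d) (Fin d) ℝ} (hM : M.IsHermitian) (θ : ℝ) :
    (NormedSpace.exp (θ • M)).trace = ∑ i, Real.exp (θ * hM.eigenvalues i) := by
  set U : Matrix (Fin d) (Fin d) ℝ := (hM.eigenvectorUnitary : Matrix (Fin d) (Fin d) ℝ)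
  have hUU : star U * U = 1 := Unitary.coe_star_mul_self hM.eigenvectorUnitary
  have hUi : U⁻¹ = star U := Matrix.inv_eq_left_inv hUU
  have hUu : IsUnit U := (Unitary.toUnits hM.eigenvectorUnitary).isUnit
  have hMd : θ • M = U * Matrix.diagonal (θ • hM.eigenvalues) * U⁻¹ := by
    have h : M = U * Matrix.diagonal hM.eigenvalues * U⁻¹ := by
      rw [hUi]
      have := hM.spectral_theorem
      rw [Unitary.conjStarAlgAut_apply] at this
      simpa using this
    rw [Matrix.diagonal_smul, mul_smul_comm, smul_mul_assoc, ← h]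
  rw [hMd, Matrix.exp_conj U _ hUu, hUi, Matrix.trace_mul_comm, ← mul_assoc, hUU, one_mul,
    Matrix.exp_diagonal, Matrix.trace_diagonal]
  refine Finset.sum_congr rfl fun i _ => ?_
  rw [Pi.coe_exp, Real.exp_eq_exp_ℝ]
  rfl

lemma norm_eq_norm_eigenvalues {M : Matrix (Fin d) (Fin d) ℝ} (hM : M.IsHermitian) :
    ‖M‖ = ‖hM.eigenvalues‖ := by
  conv_lhs => rw [hM.spectral_theorem, Unitary.conjStarAlgAut_apply]
  rw [← Unitary.coe_star, CStarRing.norm_mul_coe_unitary, CStarRing.norm_coe_unitary_mul,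
    Matrix.l2_opNorm_diagonal]
  rfl

/-- Some eigenvalue has absolute value at least `t`; according to its sign, it contributes at least
`exp (θ * t)` to one of the two traces, and all other terms are nonnegative. -/
lemma exp_le_trace_exp_add {M : Matrix (Fin d) (Fin d) ℝ} (hM : M.IsHermitian) {t θ : ℝ}
    (ht : 0 < t) (htM : t ≤ ‖M‖) (hθ : 0 ≤ θ) :
    Real.exp (θ * t) ≤ (NormedSpace.exp (θ • M)).trace + (NormedSpace.exp ((-θ) • M)).trace := by
  obtain ⟨i, hi⟩ : ∃ i, t ≤ |hM.eigenvalues i| := by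
    by_contra h
    push Not at h
    rw [norm_eq_norm_eigenvalues hM] at htM
    exact absurd ((pi_norm_lt_iff ht).2 h) (not_lt.2 htM)
  have hle : ∀ φ : ℝ, Real.exp (φ * hM.eigenvalues i) ≤ (NormedSpace.exp (φ • M)).trace := by
    intro φ
    rw [trace_exp_smul hM]
    exact Finset.single_le_sum (f := fun i => Real.exp (φ * hM.eigenvalues i))
      (fun _ _ => Real.exp_nonneg _) (Finset.mem_univ i)
  have h1 := hle θ
  have h2 := hle (-θ)
  rcases le_abs.1 hi with h | h
  · have : Real.exp (θ * t) ≤ Real.exp (θ * hM.eigenvalues i) :=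
      Real.exp_le_exp.2 (mul_le_mul_of_nonneg_left h hθ)
    linarith [Real.exp_nonneg (-θ * hM.eigenvalues i)]
  · have : Real.exp (θ * t) ≤ Real.exp (-θ * hM.eigenvalues i) :=
      Real.exp_le_exp.2 (by rw [neg_mul, ← mul_neg]; exact mul_le_mul_of_nonneg_left h hθ)
    linarith [Real.exp_nonneg (θ * hM.eigenvalues i)]

lemma trace_exp_smul_le {M : Matrix (Fin d) (Fin d) ℝ} (hM : M.IsHermitian) {c : ℝ} (hc : 0 ≤ c) :
    (NormedSpace.exp (c • M)).trace ≤ d * Real.exp (c * ‖M‖) := by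
  rw [trace_exp_smul hM]
  refine (Finset.sum_le_card_nsmul _ _ _ fun i _ => ?_).trans (le_of_eq (by
    rw [Finset.card_univ, Fintype.card_fin, nsmul_eq_mul]))
  refine Real.exp_le_exp.2 (mul_le_mul_of_nonneg_left ?_ hc)
  rw [norm_eq_norm_eigenvalues hM]
  exact (le_abs_self _).trans (norm_le_pi_norm hM.eigenvalues i)

lemma sq_le_smul_one {M : Matrix (Fin d) (Fin d) ℝ} (hM : M.IsHermitian) {R : ℝ} (hR : ‖M‖ ≤ R) :
    M ^ 2 ≤ (R ^ 2) • 1 := by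
  have hs : IsSelfAdjoint M := hM
  rw [← Algebra.algebraMap_eq_smul_one]
  have h : cfc (fun x : ℝ => x ^ 2) M ≤ algebraMap ℝ _ (R ^ 2) := by
    refine cfc_le_algebraMap _ _ _ fun x hx => ?_
    rw [hM.spectrum_real_eq_range_eigenvalues] at hx
    obtain ⟨i, rfl⟩ := hx
    have : |hM.eigenvalues i| ≤ R :=
      (norm_le_pi_norm hM.eigenvalues i).trans (norm_eq_norm_eigenvalues hM ▸ hR)
    exact sq_le_sq' (abs_le.1 this).1 (abs_le.1 this).2
  rwa [cfc_pow_id M 2] at h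

end Spectral

/-! ### The tail bound -/

section Tail

variable {n d : ℕ}

theorem sum_weight_tail_le {w : (Fin n → Bool) → ℝ} (hw : ∀ x, 0 ≤ w x) (hw1 : ∑ x, w x = 1)
    (hsc : SwapCoupled w) {k : ℕ} (hhom : ∀ x, w x ≠ 0 → ∑ i, bit (x i) = k)
    {f : (Fin n → Bool) → Matrix (Fin d) (Fin d) ℝ} (hf : ∀ x, (f x).IsHermitian)
    {A : Fin n → Matrix (Fin d) (Fin d) ℝ} (hA : ∀ i, (A i).IsHermitian)
    (hfA : ∀ i x, (f x - f (xorBasis x i)) ^ 2 ≤ A i ^ 2) {R : ℝ} (hR0 : 0 ≤ R)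
    (hR : ∀ i, ‖A i‖ ≤ R) {t θ : ℝ} (ht : 0 < t) (hθ0 : 0 ≤ θ) (hθ : θ * R ≤ 1 / 40) :
    ∑ x ∈ Finset.univ.filter (fun x => t ≤ ‖f x - ∑ y, w y • f y‖), w x ≤
      2 * d * Real.exp (32 * θ ^ 2 * ‖∑ x, w x • ∑ i, bit (x i) • A i ^ 2‖ - θ * t) := by
  set Ef := ∑ y, w y • f y with hEf
  set V := ∑ x, w x • ∑ i, bit (x i) • A i ^ 2 with hV
  have hon : onesOn (∅ : Finset (Fin n)) = Finset.univ := by ext x; simp [onesOn]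
  have hmass : mass w ∅ = 1 := by rw [mass, hon, hw1]
  have hmean : ∀ {E : Type} [AddCommGroup E] [Module ℝ E] (G : (Fin n → Bool) → E),
      mean w ∅ G = ∑ x, w x • G x := by
    intro E _ _ G
    rw [mean, hmass, hon, inv_one, one_smul]
  have hk : ∃ x, w x ≠ 0 := by
    by_contra h
    push Not at h
    simp [h] at hw1
  have hAh : ∀ i, (A i ^ 2).IsHermitian := fun i => (hA i).pow 2
  have hEfh : Ef.IsHermitian := isHermitian_sum_smul _ _ fun x _ => hf x
  have hVh : V.IsHermitian :=
    isHermitian_sum_smul _ _ fun x _ => isHermitian_sum_smul _ _ fun i _ => hAh i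
  have hVm : mean w ∅ (restSum (fun i => A i ^ 2) ∅) = V := by
    rw [hmean, hV]
    simp only [restSum, Finset.compl_empty]
  have hmgf : ∀ φ : ℝ, φ ^ 2 = θ ^ 2 →
      ∑ x, w x * (NormedSpace.exp (φ • (f x - Ef))).trace ≤
        d * Real.exp (32 * θ ^ 2 * ‖V‖) := by
    intro φ hφ
    -- Nothing is revealed yet: `T = ∅` with `k` ones remaining. The choice `H = -φ • Ef` centres
    -- `f` and cancels its mean on the right, leaving only the compensator `32 θ² V`; here `ρ = R²`.
    have h := mean_trace_exp_le hw hsc hhom (fun i => sq_nonneg_of_isHermitian (hA i))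
      (sq_nonneg R) (fun i => sq_le_smul_one (hA i) (hR i)) (fun i => ?_) hf hfA (θ := φ) ?_ k ∅
      (by simp) (by rw [hmass]; exact one_pos) (H := (-φ) • Ef) (hEfh.smul (star_trivial _))
    · rw [hmean, hmean, hVm, ← hEf, neg_smul, neg_add_cancel, zero_add, hφ] at h
      refine le_trans (le_of_eq ?_) (h.trans (trace_exp_smul_le hVh (by positivity)))
      refine Finset.sum_congr rfl fun x _ => ?_
      rw [smul_eq_mul, smul_sub, neg_add_eq_sub]
    -- Conjugating `A i ^ 2 ≤ R² • 1` by `A i` gives the required `(A i ^ 2)² ≤ R² • A i ^ 2`.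
    · have h1 := star_left_conjugate_le_conjugate (sq_le_smul_one (hA i) (hR i)) (A i)
      rw [show star (A i) = A i from hA i] at h1
      refine le_trans (le_of_eq ?_) (h1.trans (le_of_eq ?_))
      · noncomm_ring
      · rw [mul_smul_comm, mul_one, smul_mul_assoc, sq (A i)]
    · rw [hφ, ← mul_pow]
      calc (θ * R) ^ 2 ≤ (1 / 40) ^ 2 := pow_le_pow_left₀ (mul_nonneg hθ0 hR0) hθ 2
        _ = 1 / 1600 := by norm_num
  have h1 := hmgf θ rfl
  have h2 := hmgf (-θ) (neg_sq θ)
  have h3 : Real.exp (θ * t) * ∑ x ∈ Finset.univ.filter (fun x => t ≤ ‖f x - Ef‖), w x ≤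
      ∑ x, w x * (NormedSpace.exp (θ • (f x - Ef))).trace
        + ∑ x, w x * (NormedSpace.exp ((-θ) • (f x - Ef))).trace := by
    rw [← Finset.sum_add_distrib, Finset.mul_sum]
    have htr : ∀ x (φ : ℝ), 0 ≤ (NormedSpace.exp (φ • (f x - Ef))).trace := fun x φ =>
      (Matrix.nonneg_iff_posSemidef.1 (exp_nonneg_of_isHermitian
        (((hf x).sub hEfh).smul (star_trivial φ)))).trace_nonneg
    refine (Finset.sum_le_sum fun x hx => ?_).trans (Finset.sum_le_sum_of_subset_of_nonneg
      (Finset.filter_subset _ _) fun x _ _ => add_nonneg (mul_nonneg (hw x) (htr x _))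
        (mul_nonneg (hw x) (htr x _)))
    rw [← mul_add, mul_comm]
    exact mul_le_mul_of_nonneg_left (exp_le_trace_exp_add ((hf x).sub hEfh) ht
      (Finset.mem_filter.1 hx).2 hθ0) (hw x)
  rw [Real.exp_sub, ← mul_div_assoc, le_div_iff₀ (Real.exp_pos _), mul_comm]
  linarith

end Tail

lemma bernsteinRate_le_div_norm (t s R : ℝ) (hR : 0 < R) :
    bernsteinRate t s R ≤ ENNReal.ofReal (t / R) := by
  rw [ENNReal.ofReal_div_of_pos hR]
  exact min_le_right _ _

lemma bernsteinRate_le_div_variance (t s R : ℝ) (hs : 0 < s) :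
    bernsteinRate t s R ≤ ENNReal.ofReal (t ^ 2 / s) := by
  rw [ENNReal.ofReal_div_of_pos hs]
  exact min_le_left _ _

lemma ofReal_exp_le_exp_neg_rate {a : ℝ≥0∞} {v c : ℝ} (hc : 0 ≤ c) (hv : 0 ≤ v)
    (h : a ≤ ENNReal.ofReal v) :
    ENNReal.ofReal (Real.exp (-(c * v))) ≤ EReal.exp (((-c : ℝ) : EReal) * (a : EReal)) := by
  have ha : a ≠ ∞ := (h.trans_lt ENNReal.ofReal_lt_top).ne
  lift a to NNReal using ha
  have hav : (a : ℝ) ≤ v := by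
    have := ENNReal.toReal_mono ENNReal.ofReal_ne_top h
    rwa [ENNReal.toReal_ofReal hv] at this
  have e : ((a : ℝ≥0∞) : EReal) = ((a : ℝ) : EReal) := rfl
  rw [e, ← EReal.coe_mul, EReal.exp_coe]
  refine ENNReal.ofReal_le_ofReal (Real.exp_le_exp.2 ?_)
  rw [neg_mul]
  exact neg_le_neg (mul_le_mul_of_nonneg_left hav hc)

theorem tail_le {Ω : Type*} [MeasurableSpace Ω] (P : Measure Ω) [IsProbabilityMeasure P]
    {n d k : ℕ} {X : Ω → Fin n → Bool} (hX : AEMeasurable X P)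
    (hhom : IsHomogeneous k (P.map X)) (hscp : StochasticCovering (P.map X))
    {f : (Fin n → Bool) → Matrix (Fin d) (Fin d) ℝ} (hf : ∀ x, (f x).IsSymm)
    {A : Fin n → Matrix (Fin d) (Fin d) ℝ} (hA : ∀ i, (A i).PosSemidef)
    (hfA : ∀ i x, ((A i) ^ 2 - (f x - f (xorBasis x i)) ^ 2).PosSemidef)
    {t θ : ℝ} (ht : 0 < t) (hθ0 : 0 ≤ θ) (hθ : θ * maxNorm A ≤ 1 / 40) :
    P {ω | t ≤ ‖f (X ω) - ∫ ω', f (X ω') ∂P‖} ≤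
      ENNReal.ofReal (2 * d * Real.exp (32 * θ ^ 2 * varianceProxy P X A - θ * t)) := by
  set μ := P.map X with hμ
  have hμp : IsProbabilityMeasure μ := Measure.isProbabilityMeasure_map hX
  have hint : ∀ G : (Fin n → Bool) → Matrix (Fin d) (Fin d) ℝ,
      ∫ ω, G (X ω) ∂P = ∑ x, μ.real {x} • G x := by
    intro G
    rw [← integral_map hX StronglyMeasurable.of_discrete.aestronglyMeasurable,
      integral_fintype Integrable.of_finite]
  have hw1 : ∑ x, μ.real {x} = 1 := by
    rw [sum_measureReal_singleton, Finset.coe_univ, probReal_univ]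
  have hhom' : ∀ x, μ.real {x} ≠ 0 → ∑ i, bit (x i) = k := by
    intro x hx
    by_contra h
    refine hx ?_
    rw [measureReal_eq_zero_iff]
    refine measure_mono_null ?_ (ae_iff.1 hhom)
    rintro _ rfl
    exact h
  have hR : ∀ i, ‖A i‖ ≤ maxNorm A := fun i =>
    le_ciSup (f := fun i => ‖A i‖) (Set.finite_range _).bddAbove i
  have h := sum_weight_tail_le (w := fun x => μ.real {x}) (fun _ => measureReal_nonneg) hw1
    (hscp.swapCoupled hhom') hhom' (f := f) (fun x => hf x) (fun i => (hA i).1) hfA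
    (Real.iSup_nonneg fun i => norm_nonneg (A i)) hR ht hθ0 hθ
  rw [varianceProxy, hint (fun x => ∑ i, bit (x i) • A i ^ 2), hint f]
  refine le_trans ?_ (ENNReal.ofReal_le_ofReal h)
  rw [sum_measureReal_singleton, ofReal_measureReal, hμ,
    Measure.map_apply_of_aemeasurable hX (Finset.measurableSet _)]
  refine measure_mono fun ω hω => ?_
  simpa using hω

end BinaryConcentration

/-! ### Optimization of the parameter and the absolute constant -/

theorem theorem3p8 :
    ∃ C : ℝ, 0 < C ∧
      ∀ {Ω : Type*} [MeasurableSpace Ω] (P : Measure Ω) [IsProbabilityMeasure P]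
        (n d k : ℕ) (_hd : 1 ≤ d)
        (X : Ω → Fin n → Bool) (_hX : AEMeasurable X P)
        (_hhom : BinaryConcentration.IsHomogeneous k (P.map X))
        (_hscp : BinaryConcentration.StochasticCovering (P.map X))
        (f : (Fin n → Bool) → Matrix (Fin d) (Fin d) ℝ) (_hf : ∀ x, (f x).IsSymm)
        (A : Fin n → Matrix (Fin d) (Fin d) ℝ) (_hA : ∀ i, (A i).PosSemidef)
        (_hfA : ∀ (i : Fin n) (x : Fin n → Bool),
          ((A i) ^ 2 - (f x - f (BinaryConcentration.xorBasis x i)) ^ 2).PosSemidef)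
        (t : ℝ) (_ht : 0 ≤ t),
        P {ω | t ≤ ‖f (X ω) - ∫ ω', f (X ω') ∂P‖} ≤
          2 * (d : ℝ≥0∞) *
            EReal.exp (((-(1 / C) : ℝ) : EReal) *
              ((BinaryConcentration.bernsteinRate t
                (BinaryConcentration.varianceProxy P X A)
                (BinaryConcentration.maxNorm A) : ℝ≥0∞) : EReal)) := by
  refine ⟨128, by norm_num, ?_⟩
  intro Ω _ P _ n d k hd X hX hhom hscp f hf A hA hfA t ht
  rcases ht.eq_or_lt with rfl | ht
  -- At `t = 0` the rate is `0`, also when a denominator vanishes because `0 / 0 = 0`, and the bound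
  -- `2 d ≥ 1` is trivial.
  · have h1 : (1 : ℝ≥0∞) ≤ d := by exact_mod_cast hd
    have h2 : (1 : ℝ≥0∞) ≤ 2 * d := h1.trans (le_mul_of_one_le_left zero_le one_le_two)
    simpa [BinaryConcentration.bernsteinRate] using (prob_le_one (μ := P) (s := Set.univ)).trans h2
  set s := BinaryConcentration.varianceProxy P X A with hs
  set R := BinaryConcentration.maxNorm A with hR
  have hR0 : 0 ≤ R := Real.iSup_nonneg fun i => norm_nonneg (A i)
  have hs0 : 0 ≤ s := norm_nonneg _
  have htail : ∀ θ : ℝ, 0 ≤ θ → θ * R ≤ 1 / 40 →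
      P {ω | t ≤ ‖f (X ω) - ∫ ω', f (X ω') ∂P‖} ≤
        ENNReal.ofReal (2 * d * Real.exp (32 * θ ^ 2 * s - θ * t)) := fun θ h0 h1 =>
    BinaryConcentration.tail_le P hX hhom hscp hf hA hfA ht h0 h1
  have hfin : ∀ θ v : ℝ, 0 ≤ θ → θ * R ≤ 1 / 40 → 0 ≤ v →
      32 * θ ^ 2 * s - θ * t ≤ -(1 / 128 * v) →
      BinaryConcentration.bernsteinRate t s R ≤ ENNReal.ofReal v →
      P {ω | t ≤ ‖f (X ω) - ∫ ω', f (X ω') ∂P‖} ≤ 2 * (d : ℝ≥0∞) *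
        EReal.exp (((-(1 / 128) : ℝ) : EReal) *
          ((BinaryConcentration.bernsteinRate t s R : ℝ≥0∞) : EReal)) := by
    intro θ v h0 h1 hv h2 h3
    refine (htail θ h0 h1).trans ?_
    have e : (2 * (d : ℝ≥0∞)) = ENNReal.ofReal (2 * d) := by
      rw [ENNReal.ofReal_mul zero_le_two, ENNReal.ofReal_natCast, ENNReal.ofReal_ofNat]
    rw [ENNReal.ofReal_mul (by positivity), e]
    gcongr
    refine le_trans (ENNReal.ofReal_le_ofReal (Real.exp_le_exp.2 h2)) ?_
    exact BinaryConcentration.ofReal_exp_le_exp_neg_rate (by norm_num) hv h3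
  rcases hR0.eq_or_lt with hR00 | hRpos
  · have hs00 : s = 0 := by
      have hA0 : ∀ i, A i = 0 := fun i => norm_le_zero_iff.1
        ((le_ciSup (f := fun i => ‖A i‖) (Set.finite_range _).bddAbove i).trans_eq hR00.symm)
      simp [hs, BinaryConcentration.varianceProxy, hA0]
    -- When `R = 0` the parameter `θ` is unconstrained and the variance term vanishes, so `θ → ∞`
    -- shows that the tail probability is zero.
    have hlim : Filter.Tendsto (fun θ : ℝ => ENNReal.ofReal (2 * d * Real.exp (-(θ * t))))
        Filter.atTop (nhds 0) := by
      have h1 : Filter.Tendsto (fun θ : ℝ => 2 * d * Real.exp (-(θ * t))) Filter.atTop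
          (nhds (2 * d * 0)) :=
        (Real.tendsto_exp_neg_atTop_nhds_zero.comp
          (Filter.tendsto_id.atTop_mul_const ht)).const_mul _
      rw [mul_zero] at h1
      simpa using ENNReal.tendsto_ofReal h1
    have h0 : P {ω | t ≤ ‖f (X ω) - ∫ ω', f (X ω') ∂P‖} ≤ 0 := by
      refine ge_of_tendsto hlim ((Filter.eventually_ge_atTop 0).mono fun θ hθ => ?_)
      have := htail θ hθ (by rw [← hR00]; norm_num)
      rwa [hs00, mul_zero, zero_sub] at this
    exact h0.trans zero_le
  by_cases hcase : 0 < s ∧ t * (40 * R) ≤ 64 * s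
  · obtain ⟨hspos, hle⟩ := hcase
    -- The unconstrained minimizer of `32 θ² s - θ t`, with value `-t² / (128 s)`; this is the
    -- source of the constant `128`. The case condition says that it satisfies `θ R ≤ 1 / 40`.
    refine hfin (t / (64 * s)) (t ^ 2 / s) (by positivity) ?_ (by positivity) ?_
      (BinaryConcentration.bernsteinRate_le_div_variance t s R hspos)
    · rw [div_mul_eq_mul_div, div_le_div_iff₀ (by positivity) (by norm_num)]
      linarith
    · refine le_of_eq ?_
      field_simp
      ring
  · have hle : 64 * s ≤ t * (40 * R) := by
      by_contra h
      push Not at h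
      exact hcase ⟨by nlinarith [mul_pos ht hRpos], h.le⟩
    -- The largest admissible `θ`. Here `64 s ≤ 40 R t` makes the quadratic term at most half of the
    -- linear one, so the exponent is at most `-t / (80 R)`.
    refine hfin (1 / (40 * R)) (t / R) (by positivity) ?_ (by positivity) ?_
      (BinaryConcentration.bernsteinRate_le_div_norm t s R hRpos)
    · refine le_of_eq ?_
      field_simp
    · have e : 32 * (1 / (40 * R)) ^ 2 * s = (64 * s) / (3200 * R ^ 2) := by field_simp; ring
      have h1 : (64 * s) / (3200 * R ^ 2) ≤ t * (40 * R) / (3200 * R ^ 2) := by gcongr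
      have e2 : t * (40 * R) / (3200 * R ^ 2) = t / R * (1 / 80) := by field_simp; norm_num
      have e3 : 1 / (40 * R) * t = t / R * (1 / 40) := by field_simp
      have : 0 < t / R := by positivity
      rw [e, e3]
      linarith
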